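/- **Setting.** Clients $i=1,\dots,M$ hold data $(x_{ij},y_{ij})$, $1\le j\le n_i$, $n_i\ge 1$, and $N=\sum_i n_i$, $w_i=n_i/N$. Let $\phi:\mathcal X\to\mathbb R^d$ be a feature map, $k(a,b)=\langle\phi(a),\phi(b)\rangle$, and let functions $f=\langle\phi,\theta\rangle$ be identified with their coefficients $\theta\in\mathbb R^d$ (Euclidean norm). The responses are $y_{ij}=\langle\phi(x_{ij}),\theta_i^*\rangle+\xi_{ij}$ with independent zero-mean noises $\xi_{ij}$ of variance at most $\sigma^2$; $\mathbb E_\xi$ is the expectation over the noise with the covariates fixed. Let $\ell_i(\theta)=\frac1{2n_i}\sum_j(\langle\phi(x_{ij}),\theta\rangle-y_{ij})^2$ and $\eta>0$. From $\theta_0$, the global model is $\theta_t=\sum_i w_i\theta_{i,t}$, where, for FedAvg, $\theta_{i,t}$ results from $\theta_{t-1}$ by $s\ge1$ gradient steps $\theta\mapsto\theta-\eta\nabla\ell_i(\theta)$ and, for FedProx (where we put $s=1$), $\theta_{i,t}=\arg\min_\theta\ \ell_i(\theta)+\frac1{2\eta}\|\theta-\theta_{t-1}\|^2$. Put $C_i=\frac1{n_i}\sum_j\phi(x_{ij})\phi(x_{ij})^\top$.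 Let $\mathcal L=\sum_i w_i(I-\eta C_i)^s$ and $\Psi_{ij}=\frac{\eta}{n_i}\sum_{\tau<s}(I-\eta C_i)^\tau\phi(x_{ij})$ for FedAvg, and $\mathcal L=\sum_i w_i(I+\eta C_i)^{-1}$ and $\Psi_{ij}=\frac{\eta}{n_i}(I+\eta C_i)^{-1}\phi(x_{ij})$ for FedProx. When $I-\mathcal L$ is invertible, let $$\bar\theta=(I-\mathcal L)^{-1}\sum_i w_i\sum_j\langle\phi(x_{ij}),\theta_i^*\rangle\Psi_{ij}.$$ Let $\gamma=\eta\max_i\|K_i\|$, where $K_i$ is the matrix with entries $k(x_{ij},x_{il})/n_i$ and $\|\cdot\|$ is the spectral norm, let $\kappa=\frac{\gamma s}{1-(1-\gamma)^s}$ for FedAvg and $\kappa=1+\gamma$ for FedProx, and let $\Gamma=\max_{i,j}\|\theta_i^*-\theta_j^*\|$. **Statement.** Let $\alpha,\beta,K>0$. There are constants $c_1,c_2,c_3>0$ depending only on $\alpha,\beta,K$ such that the following holds. Suppose that the random feature vectors $\phi(x_{ij})$ are independent and sub-Gaussian with norm at most $K$ (that is, $\mathbb E\exp(\langle u,\phi(x_{ij})\rangle^2/K^2)\le2$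 for all unit vectors $u$), that $\alpha I\preceq\mathbb E[\phi(x_{ij})\phi(x_{ij})^\top]\preceq\beta I$ for all $i,j$, and that $N\ge c_1d$. Then there are events $E,E'$ of the covariates with $$\mathbb P(E)\ge1-e^{-d},\qquad \mathbb P(E)\ge 1-e^{-c_3N},\qquad \mathbb P(E')\ge1-e^{-N},$$ such that for both algorithms, every $\eta>0$ and $s\ge1$ (in the case of FedAvg provided that $\gamma<1$): 1. on $E$, the operator $I-\mathcal L$ is invertible and, for all $\theta_0$, all $t\ge0$, all $\sigma$ and all noise distributions as above, $$\mathbb E_\xi\|\theta_t-\bar\theta\|^2\le\Bigl(1-\frac{s\eta\alpha}{2\kappa}\Bigr)^{2t}\|\theta_0-\bar\theta\|^2+\sigma^2\,\frac{2\kappa d}{N\alpha};$$ 2. on $E\cap E'$, for all $j$, $$\|\bar\theta-\theta_j^*\|\le c_2\,\Gamma\sqrt{\kappa}.$$ -/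

import Mathlib

open MeasureTheory ProbabilityTheory

noncomputable section

namespace FedLearn

/-- Model coefficients: `ℝ^d` with the Euclidean norm. -/
abbrev Coef (d : ℕ) : Type := EuclideanSpace ℝ (Fin d)

/-- The two training algorithms. `fedAvg s` runs `s` local gradient steps per round;
`fedProx` solves one proximal problem per round. -/
inductive FLAlgorithm where
  | fedAvg (s : ℕ) : FLAlgorithm
  | fedProx : FLAlgorithm

/-- The parameter `s`: the number of local steps of FedAvg; `s = 1` for FedProx. -/
def FLAlgorithm.steps : FLAlgorithm → ℕ
  | .fedAvg s => s
  | .fedProx => 1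

section Client

variable {𝒳 : Type*} {d m : ℕ}

/-- The function `f = ⟨φ, θ⟩` with coefficient `θ`, evaluated at `a`. -/
def modelValue (φ : 𝒳 → Coef d) (θ : Coef d) (a : 𝒳) : ℝ := inner ℝ (φ a) θ

/-- The kernel `k(a, b) = ⟨φ(a), φ(b)⟩`. -/
def kern (φ : 𝒳 → Coef d) (a b : 𝒳) : ℝ := inner ℝ (φ a) (φ b)

/-- The normalized Gram matrix `K_x` of the `m` points `x`, with entries `k(x_a, x_b) / m`. -/
def gram (φ : 𝒳 → Coef d) (x : Fin m → 𝒳) : Matrix (Fin m) (Fin m) ℝ :=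
  Matrix.of fun a b => kern φ (x a) (x b) / m

/-- The empirical risk `(1 / (2m)) ∑ j, (f(x_j) - y_j)²` of a client, as a function of the
coefficient of `f`. -/
def localRisk (φ : 𝒳 → Coef d) (x : Fin m → 𝒳) (y : Fin m → ℝ) (θ : Coef d) : ℝ :=
  1 / (2 * (m : ℝ)) * ∑ j, (modelValue φ θ (x j) - y j) ^ 2

/-- The local update with step size `η` for the local risk `ℓ`, started from the global model `θ`:
`s` gradient steps for FedAvg, the minimizer of the proximal objective for FedProx. -/
def localUpdate (alg : FLAlgorithm) (η : ℝ) (ℓ : Coef d → ℝ) (θ : Coef d) : Coef d :=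
  match alg with
  | .fedAvg s => (fun ϑ => ϑ - η • gradient ℓ ϑ)^[s] θ
  | .fedProx => Classical.epsilon fun ϑ =>
      IsMinOn (fun ϑ' => ℓ ϑ' + 1 / (2 * η) * ‖ϑ' - θ‖ ^ 2) Set.univ ϑ

/-- The operator `f ↦ (1/m) ∑ j, f(x_j) k_{x_j}`, in coefficients
`θ ↦ (1/m) ∑ j, ⟨φ(x_j), θ⟩ φ(x_j)`. -/
def covOp (φ : 𝒳 → Coef d) (x : Fin m → 𝒳) : Coef d →L[ℝ] Coef d :=
  (1 / (m : ℝ)) • ∑ j, (innerSL ℝ (φ (x j))).smulRight (φ (x j))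

/-- A client's contribution to the round operator: `𝓛_i ^ s` with `𝓛_i = I - η covOp` for FedAvg,
and `(I + η covOp)⁻¹` for FedProx. -/
def localOp (alg : FLAlgorithm) (η : ℝ) (φ : 𝒳 → Coef d) (x : Fin m → 𝒳) :
    Coef d →L[ℝ] Coef d :=
  match alg with
  | .fedAvg s => (1 - η • covOp φ x) ^ s
  | .fedProx => Ring.inverse (1 + η • covOp φ x)

/-- The entries of `Ψ_i`: `(η/m) ∑_{τ<s} 𝓛_i^τ k_{x_j}` for FedAvg, and
`(η/m) (I + η covOp)⁻¹ k_{x_j}` for FedProx (`k_{x_j}` has coefficient `φ(x_j)`). -/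
def localPsi (alg : FLAlgorithm) (η : ℝ) (φ : 𝒳 → Coef d) (x : Fin m → 𝒳) (j : Fin m) : Coef d :=
  match alg with
  | .fedAvg s => (η / m) • ∑ τ ∈ Finset.range s, ((1 - η • covOp φ x) ^ τ) (φ (x j))
  | .fedProx => (η / m) • Ring.inverse (1 + η • covOp φ x) (φ (x j))

end Client

section System

variable {𝒳 : Type*} {d M : ℕ} {n : Fin M → ℕ}

/-- The total number `N` of data points. -/
def total (n : Fin M → ℕ) : ℕ := ∑ i, n i

/-- The aggregation weight `w_i = n_i / N`. -/
def weight (n : Fin M → ℕ) (i : Fin M) : ℝ := (n i : ℝ) / (total n : ℝ)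

/-- The coefficient `θ_t` of the global model after `t` rounds on the data `(x, y)`. -/
def globalModel (alg : FLAlgorithm) (η : ℝ) (φ : 𝒳 → Coef d) (x : ∀ i, Fin (n i) → 𝒳)
    (y : ∀ i, Fin (n i) → ℝ) (θ₀ : Coef d) : ℕ → Coef d
  | 0 => θ₀
  | t + 1 => ∑ i, weight n i •
      localUpdate alg η (localRisk φ (x i) (y i)) (globalModel alg η φ x y θ₀ t)

/-- The responses `y_{ij} = f_i^*(x_{ij}) + z_{ij}`, where `θs i` is the coefficient of `f_i^*`. -/
def response (φ : 𝒳 → Coef d) (x : ∀ i, Fin (n i) → 𝒳) (θs : Fin M → Coef d)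
    (z : ∀ i, Fin (n i) → ℝ) : ∀ i, Fin (n i) → ℝ :=
  fun i j => modelValue φ (θs i) (x i j) + z i j

/-- The operator `𝓛 = ∑ i, w_i 𝓛_i^s` (FedAvg) or `∑ i, w_i (I + η covOp_i)⁻¹` (FedProx). -/
def roundOp (alg : FLAlgorithm) (η : ℝ) (φ : 𝒳 → Coef d) (x : ∀ i, Fin (n i) → 𝒳) :
    Coef d →L[ℝ] Coef d :=
  ∑ i, weight n i • localOp alg η φ (x i)

/-- `z · Ψ` with `Ψ = (w_1 Ψ_1, …, w_M Ψ_M)`. -/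
def dotPsi (alg : FLAlgorithm) (η : ℝ) (φ : 𝒳 → Coef d) (x : ∀ i, Fin (n i) → 𝒳)
    (z : ∀ i, Fin (n i) → ℝ) : Coef d :=
  ∑ i, ∑ j, z i j • weight n i • localPsi alg η φ (x i) j

/-- The coefficient of `(I - 𝓛)⁻¹ ((f_1^*(x_1), …, f_M^*(x_M)) · Ψ)`; meaningful when `I - 𝓛` is
invertible. -/
def thetaBar (alg : FLAlgorithm) (η : ℝ) (φ : 𝒳 → Coef d) (x : ∀ i, Fin (n i) → 𝒳)
    (θs : Fin M → Coef d) : Coef d :=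
  Ring.inverse (1 - roundOp alg η φ x)
    (dotPsi alg η φ x fun i j => modelValue φ (θs i) (x i j))

/-- `γ = η max_i ‖K_{x_i}‖`, with the spectral norm. -/
def gam (η : ℝ) (φ : 𝒳 → Coef d) (x : ∀ i, Fin (n i) → 𝒳) : ℝ :=
  η * ⨆ i, ‖Matrix.toEuclideanCLM (𝕜 := ℝ) (gram φ (x i))‖

/-- `κ = γ s / (1 - (1 - γ)^s)` for FedAvg and `κ = 1 + γ` for FedProx. -/
def kap (alg : FLAlgorithm) (η : ℝ) (φ : 𝒳 → Coef d) (x : ∀ i, Fin (n i) → 𝒳) : ℝ :=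
  match alg with
  | .fedAvg s => gam η φ x * s / (1 - (1 - gam η φ x) ^ s)
  | .fedProx => 1 + gam η φ x

/-- The model heterogeneity `Γ = max_{i,j} ‖θ_i^* - θ_j^*‖`. -/
def heterogeneity (θs : Fin M → Coef d) : ℝ := ⨆ p : Fin M × Fin M, ‖θs p.1 - θs p.2‖

/-- `ν` is an admissible law of the noise vector: independent zero-mean coordinates with
variance at most `σ²`. -/
structure IsNoiseLaw (σ : ℝ) (ν : Measure (∀ i, Fin (n i) → ℝ)) : Prop where
  isProb : IsProbabilityMeasure ν
  indep : iIndepFun (fun (k : Σ i, Fin (n i)) (z : ∀ i, Fin (n i) → ℝ) => z k.1 k.2) ν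
  memLp : ∀ i j, MemLp (fun z : ∀ i, Fin (n i) → ℝ => z i j) 2 ν
  mean : ∀ i j, ∫ z, z i j ∂ν = 0
  var : ∀ i j, variance (fun z : ∀ i, Fin (n i) → ℝ => z i j) ν ≤ σ ^ 2

end System

section Probability

variable {Ω : Type*} [MeasurableSpace Ω] {d : ℕ}

/-- The random vector `V` (not necessarily centered) is sub-Gaussian with norm at most `K`:
`E exp(⟨u, V⟩² / K²) ≤ 2` for every unit vector `u`. -/
def SubGaussianVec (K : ℝ) (V : Ω → Coef d) (μ : Measure Ω) : Prop :=
  ∀ u : Coef d, ‖u‖ = 1 →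
    ∫⁻ ω, ENNReal.ofReal (Real.exp ((inner ℝ u (V ω)) ^ 2 / K ^ 2)) ∂μ ≤ 2

/-- The second-moment matrix `E[V Vᵀ]`. -/
def secondMoment (V : Ω → Coef d) (μ : Measure Ω) : Matrix (Fin d) (Fin d) ℝ :=
  Matrix.of fun a b => ∫ ω, V ω a * V ω b ∂μ

end Probability

end FedLearn

end

namespace FedLearn

/-! ### Operators that are diagonal in an orthonormal basis -/

section Diagonal

variable {d : ℕ} {ι : Type*} [Fintype ι]

/-! Both algorithms act on a client as an affine map θ ↦ L_i θ + Σ_j y_ij Ψ_ij (`localUpdate_eq`).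
Here I − L_i = η P_i C_i and Ψ_ij = (η/n_i) P_i φ(x_ij), where P_i (`psiOp`) is diagonal in an
eigenbasis of C_i with eigenvalues in [s/κ, s]. The local estimates are therefore scalar
inequalities (`localBounds`), which are then averaged over the clients (`roundBounds`).

Convergence and noise: on E the pooled covariance is at least α/2, so 0 ⪯ 𝓛 ⪯ (1 − r)I with r =
ηsα/(2κ). The error θ_t − θ̄ is 𝓛^t(θ_0 − θ̄) plus Σ_{τ<t} 𝓛^τ applied to the noise. The noise
covariance is controlled by the contraction itself: Σ w_i² Ψ_ij Ψ_ijᵀ ⪯ (ηs/N)(I − 𝓛). Hence an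
eigendirection of 𝓛 with eigenvalue l contributes at most (ηs/N)(1 − l)/(1 − l)² ≤ ηs/(Nr), and d
directions give 2κd/(Nα).

Bias: put v = θ̄ − θ*_{i₀} and δ_i = θ*_i − θ*_{i₀}. Then (I − 𝓛)v = Σ w_i(I − L_i)δ_i, and
Cauchy–Schwarz in each semidefinite form I − L_i gives ⟨v, (I − 𝓛)v⟩ ≤ Σ w_i⟨δ_i, (I − L_i)δ_i⟩ ≤
(ηs/N) Σ_ij ⟨φ(x_ij), δ_i⟩². Only the final division by r costs κ, and it does so on the squared
norm; hence √κ.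

Probability: E must treat all directions at once, through Chernoff bounds on a net of the sphere
(`exists_pooled_lower_event`). E' concerns the fixed vectors δ_i, so one Chernoff bound suffices
(`exists_upper_event`). Neither event involves the algorithm, η or s. -/

lemma apply_eq_sum_of_diagonal (b : OrthonormalBasis ι ℝ (Coef d)) {T : Coef d →L[ℝ] Coef d}
    {f : ι → ℝ} (hT : ∀ k, T (b k) = f k • b k) (v : Coef d) :
    T v = ∑ k, (f k * inner ℝ (b k) v) • b k := by
  conv_lhs => rw [← b.sum_repr' v]
  simp [map_sum, hT, smul_smul, mul_comm]

lemma inner_basis_apply_of_diagonal (b : OrthonormalBasis ι ℝ (Coef d))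
    {T : Coef d →L[ℝ] Coef d} {f : ι → ℝ} (hT : ∀ k, T (b k) = f k • b k) (k : ι) (v : Coef d) :
    inner ℝ (b k) (T v) = f k * inner ℝ (b k) v := by
  classical
  rw [apply_eq_sum_of_diagonal b hT, inner_sum]
  simp [inner_smul_right, orthonormal_iff_ite.mp b.orthonormal]

lemma inner_apply_of_diagonal (b : OrthonormalBasis ι ℝ (Coef d))
    {T : Coef d →L[ℝ] Coef d} {f : ι → ℝ} (hT : ∀ k, T (b k) = f k • b k) (u v : Coef d) :
    inner ℝ u (T v) = ∑ k, f k * (inner ℝ (b k) u * inner ℝ (b k) v) := by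
  rw [← b.sum_inner_mul_inner u (T v)]
  refine Finset.sum_congr rfl fun k _ => ?_
  rw [inner_basis_apply_of_diagonal b hT, real_inner_comm u (b k)]
  ring

lemma inner_apply_comm_of_diagonal (b : OrthonormalBasis ι ℝ (Coef d))
    {T : Coef d →L[ℝ] Coef d} {f : ι → ℝ} (hT : ∀ k, T (b k) = f k • b k) (u v : Coef d) :
    inner ℝ (T u) v = inner ℝ u (T v) := by
  rw [real_inner_comm, inner_apply_of_diagonal b hT, inner_apply_of_diagonal b hT]
  exact Finset.sum_congr rfl fun k _ => by ring

lemma pow_apply_of_eq_smul {T : Coef d →L[ℝ] Coef d} {v : Coef d} {c : ℝ} (h : T v = c • v)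
    (t : ℕ) : (T ^ t) v = c ^ t • v := by
  induction t with
  | zero => simp
  | succ t ih => rw [pow_succ, mul_apply_eq_comp, h, map_smul, ih, smul_smul,
      pow_succ, mul_comm]

/-- Coercivity forces injectivity, which is bijectivity in finite dimension. -/
lemma isUnit_of_inner_ge {T : Coef d →L[ℝ] Coef d} {r : ℝ} (hr : 0 < r)
    (h : ∀ v, r * ‖v‖ ^ 2 ≤ inner ℝ v (T v)) : IsUnit T := by
  rw [ContinuousLinearMap.isUnit_iff_bijective]
  have hinj : Function.Injective (T : Coef d →ₗ[ℝ] Coef d) := by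
    refine (injective_iff_map_eq_zero _).2 fun v hv => ?_
    have h0 := h v
    have hv' : T v = 0 := hv
    rw [hv', inner_zero_right] at h0
    have : ‖v‖ ^ 2 ≤ 0 := by
      by_contra hc
      push Not at hc
      have := mul_pos hr hc
      linarith
    exact norm_eq_zero.mp (pow_eq_zero_iff two_ne_zero |>.mp (le_antisymm this (sq_nonneg _)))
  exact ⟨hinj, LinearMap.injective_iff_surjective.mp hinj⟩

lemma norm_sq_eq_sum_inner_sq (b : OrthonormalBasis ι ℝ (Coef d)) (v : Coef d) :
    ‖v‖ ^ 2 = ∑ k, inner ℝ (b k) v ^ 2 := by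
  rw [← b.sum_sq_norm_inner_right v]
  simp

lemma norm_apply_sq_le_of_diagonal (b : OrthonormalBasis ι ℝ (Coef d))
    {T : Coef d →L[ℝ] Coef d} {f : ι → ℝ} (hT : ∀ k, T (b k) = f k • b k) {c : ℝ}
    (h0 : ∀ k, 0 ≤ f k) (hc : ∀ k, f k ≤ c) (v : Coef d) : ‖T v‖ ^ 2 ≤ c ^ 2 * ‖v‖ ^ 2 := by
  rw [norm_sq_eq_sum_inner_sq b, norm_sq_eq_sum_inner_sq b v, Finset.mul_sum]
  refine Finset.sum_le_sum fun k _ => ?_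
  rw [inner_basis_apply_of_diagonal b hT, mul_pow]
  exact mul_le_mul_of_nonneg_right (pow_le_pow_left₀ (h0 k) (hc k) 2) (sq_nonneg _)

/-- A symmetric operator is diagonal in some orthonormal basis. -/
lemma exists_diagonal_basis {T : Coef d →L[ℝ] Coef d}
    (hT : ∀ u v, inner ℝ (T u) v = inner ℝ u (T v)) :
    ∃ (b : OrthonormalBasis (Fin d) ℝ (Coef d)) (f : Fin d → ℝ), ∀ k, T (b k) = f k • b k := by
  have hs : (T : Coef d →ₗ[ℝ] Coef d).IsSymmetric := hT
  refine ⟨hs.eigenvectorBasis finrank_euclideanSpace_fin,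
    hs.eigenvalues finrank_euclideanSpace_fin, fun k => ?_⟩
  exact hs.apply_eigenvectorBasis finrank_euclideanSpace_fin k

end Diagonal

/-! ### The empirical covariance and the operators built from it -/

section Local

variable {𝒳 : Type*} {d m : ℕ}

lemma covOp_apply (φ : 𝒳 → Coef d) (x : Fin m → 𝒳) (v : Coef d) :
    covOp φ x v = (1 / (m : ℝ)) • ∑ j, (inner ℝ (φ (x j)) v : ℝ) • φ (x j) := by
  simp [covOp]

lemma inner_covOp (φ : 𝒳 → Coef d) (x : Fin m → 𝒳) (u v : Coef d) :
    inner ℝ u (covOp φ x v)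
      = 1 / (m : ℝ) * ∑ j, (inner ℝ (φ (x j)) u : ℝ) * inner ℝ (φ (x j)) v := by
  rw [covOp_apply, inner_smul_right, inner_sum]
  congr 1
  refine Finset.sum_congr rfl fun j _ => ?_
  rw [inner_smul_right, real_inner_comm (φ (x j)) u, mul_comm]

lemma inner_covOp_self (φ : 𝒳 → Coef d) (x : Fin m → 𝒳) (v : Coef d) :
    inner ℝ v (covOp φ x v) = 1 / (m : ℝ) * ∑ j, (inner ℝ (φ (x j)) v : ℝ) ^ 2 := by
  simp [inner_covOp, sq]

lemma inner_covOp_self_nonneg (φ : 𝒳 → Coef d) (x : Fin m → 𝒳) (v : Coef d) :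
    0 ≤ inner ℝ v (covOp φ x v) := by
  rw [inner_covOp_self]
  positivity

/-- With g the vector of values ⟨φ(x_j), v⟩, the left side is ⟨g, Gg⟩/m for the Gram matrix G, while
⟨v, Cv⟩ = ‖g‖²/m. This is how γ comes to bound the spectrum of the covariance. -/
lemma norm_covOp_sq_le (φ : 𝒳 → Coef d) (x : Fin m → 𝒳) (v : Coef d) :
    ‖covOp φ x v‖ ^ 2
      ≤ ‖Matrix.toEuclideanCLM (𝕜 := ℝ) (gram φ x)‖ * inner ℝ v (covOp φ x v) := by
  set g : EuclideanSpace ℝ (Fin m) := WithLp.toLp 2 fun j => inner ℝ (φ (x j)) v with hg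
  set G := Matrix.toEuclideanCLM (𝕜 := ℝ) (gram φ x) with hG
  have hsq : ‖g‖ ^ 2 = ∑ j, (inner ℝ (φ (x j)) v : ℝ) ^ 2 := by
    simp [EuclideanSpace.norm_sq_eq, hg]
  have key : ‖covOp φ x v‖ ^ 2 = 1 / (m : ℝ) * inner ℝ g (G g) := by
    rw [← real_inner_self_eq_norm_sq, inner_covOp]
    congr 1
    rw [PiLp.inner_apply]
    refine Finset.sum_congr rfl fun j _ => ?_
    have : (G g) j = inner ℝ (φ (x j)) (covOp φ x v) := by
      rw [covOp_apply, inner_smul_right, inner_sum, Finset.mul_sum, hG]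
      simp only [Matrix.ofLp_toEuclideanCLM, Matrix.mulVec, dotProduct, gram, Matrix.of_apply,
        kern, hg]
      refine Finset.sum_congr rfl fun l _ => ?_
      rw [inner_smul_right]
      ring
    rw [this]
    simp [hg, mul_comm]
  rw [key, inner_covOp_self, ← hsq]
  have h1 : inner ℝ g (G g) ≤ ‖G‖ * ‖g‖ ^ 2 := by
    calc inner ℝ g (G g) ≤ ‖g‖ * ‖G g‖ := real_inner_le_norm _ _
      _ ≤ ‖g‖ * (‖G‖ * ‖g‖) := by gcongr; exact G.le_opNorm g
      _ = _ := by ring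
  calc 1 / (m : ℝ) * inner ℝ g (G g) ≤ 1 / (m : ℝ) * (‖G‖ * ‖g‖ ^ 2) := by gcongr
    _ = _ := by ring

/-- The eigenvalues of the empirical covariance lie between `0` and the norm of the Gram matrix. -/
lemma exists_covOp_basis (φ : 𝒳 → Coef d) (x : Fin m → 𝒳) :
    ∃ (b : OrthonormalBasis (Fin d) ℝ (Coef d)) (lam : Fin d → ℝ),
      (∀ k, covOp φ x (b k) = lam k • b k) ∧ (∀ k, 0 ≤ lam k) ∧
      ∀ k, lam k ≤ ‖Matrix.toEuclideanCLM (𝕜 := ℝ) (gram φ x)‖ := by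
  obtain ⟨b, lam, h⟩ := exists_diagonal_basis (T := covOp φ x) fun u v => by
    rw [real_inner_comm, inner_covOp, inner_covOp]
    simp_rw [mul_comm]
  have hb : ∀ k, ‖b k‖ = 1 := b.norm_eq_one
  have hin : ∀ k, inner ℝ (b k) (covOp φ x (b k)) = lam k := fun k => by
    rw [h, inner_smul_right, real_inner_self_eq_norm_sq, hb]; simp
  have h0 : ∀ k, 0 ≤ lam k := fun k => hin k ▸ inner_covOp_self_nonneg φ x (b k)
  refine ⟨b, lam, h, h0, fun k => ?_⟩
  have h2 := norm_covOp_sq_le φ x (b k)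
  rw [hin, h, norm_smul, hb, mul_one, Real.norm_eq_abs, sq_abs] at h2
  rcases (h0 k).eq_or_lt with h3 | h3
  · rw [← h3]; positivity
  · nlinarith

/-- The operator `P` with `Ψ_j = (η/m) P φ(x_j)` and `I - localOp = η P covOp`. -/
noncomputable def psiOp (alg : FLAlgorithm) (η : ℝ) (φ : 𝒳 → Coef d) (x : Fin m → 𝒳) : Coef d →L[ℝ] Coef d :=
  match alg with
  | .fedAvg s => ∑ τ ∈ Finset.range s, (1 - η • covOp φ x) ^ τ
  | .fedProx => Ring.inverse (1 + η • covOp φ x)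

lemma localPsi_eq (alg : FLAlgorithm) (η : ℝ) (φ : 𝒳 → Coef d) (x : Fin m → 𝒳) (j : Fin m) :
    localPsi alg η φ x j = (η / m) • psiOp alg η φ x (φ (x j)) := by
  cases alg <;> simp [localPsi, psiOp]

lemma isUnit_one_add_covOp {η : ℝ} (hη : 0 < η) (φ : 𝒳 → Coef d) (x : Fin m → 𝒳) :
    IsUnit (1 + η • covOp φ x) := by
  refine isUnit_of_inner_ge one_pos fun v => ?_
  have := mul_nonneg hη.le (inner_covOp_self_nonneg φ x v)
  simp only [add_apply, one_apply_eq_self,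
    smul_apply, inner_add_right, inner_smul_right, real_inner_self_eq_norm_sq]
  linarith

lemma smul_mul_eq_mul_smul (c : ℝ) (S T : Coef d →L[ℝ] Coef d) : c • (S * T) = S * c • T := by
  refine ContinuousLinearMap.ext fun v => ?_
  simp [mul_apply_eq_comp]

/-- A geometric sum for FedAvg, and I − (I + ηC)⁻¹ = (I + ηC)⁻¹ηC for FedProx. -/
lemma psiOp_mul_covOp {alg : FLAlgorithm} {η : ℝ} (hη : 0 < η) (φ : 𝒳 → Coef d)
    (x : Fin m → 𝒳) : η • (psiOp alg η φ x * covOp φ x) = 1 - localOp alg η φ x := by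
  cases alg with
  | fedAvg s =>
    have := geom_sum_mul_neg (1 - η • covOp φ x) s
    rw [sub_sub_cancel] at this
    rw [← smul_mul_eq_mul_smul] at this
    exact this
  | fedProx =>
    have h := Ring.inverse_mul_cancel _ (isUnit_one_add_covOp hη φ x)
    rw [mul_add, mul_one] at h
    simp only [psiOp, localOp]
    exact (sub_eq_of_eq_add' (by rw [smul_mul_eq_mul_smul, h])).symm

/-- Equivalently, θ is a fixed point of the local update on noiseless responses generated by θ
itself; this is why the bias depends only on differences of the θ*_i. -/
lemma sum_smul_localPsi {alg : FLAlgorithm} {η : ℝ} (hη : 0 < η) (φ : 𝒳 → Coef d)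
    (x : Fin m → 𝒳) (θ : Coef d) :
    ∑ j, modelValue φ θ (x j) • localPsi alg η φ x j = θ - localOp alg η φ x θ := by
  have h := congrArg (fun T : Coef d →L[ℝ] Coef d => T θ) (psiOp_mul_covOp (alg := alg) hη φ x)
  simp only [smul_apply, mul_apply_eq_comp,
    sub_apply, one_apply_eq_self] at h
  rw [← h, covOp_apply, map_smul, map_sum, smul_smul, Finset.smul_sum]
  refine Finset.sum_congr rfl fun j _ => ?_
  rw [localPsi_eq, modelValue, map_smul, smul_smul, smul_smul]
  congr 1
  ring

/-- This is Σ_j Ψ_j Ψ_jᵀ = (η²/m) P C P, read as a quadratic form. -/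
lemma sum_inner_localPsi_sq (alg : FLAlgorithm) (η : ℝ) (φ : 𝒳 → Coef d) (x : Fin m → 𝒳)
    (hP : ∀ u v, inner ℝ (psiOp alg η φ x u) v = inner ℝ u (psiOp alg η φ x v)) (v : Coef d) :
    ∑ j, (inner ℝ v (localPsi alg η φ x j) : ℝ) ^ 2
      = η ^ 2 / m * inner ℝ (psiOp alg η φ x v) (covOp φ x (psiOp alg η φ x v)) := by
  rw [inner_covOp_self, Finset.mul_sum, Finset.mul_sum]
  refine Finset.sum_congr rfl fun j _ => ?_
  rw [localPsi_eq, inner_smul_right, ← hP, real_inner_comm (φ (x j))]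
  ring

end Local

/-! ### Spectral bounds for one client and the affine form of its update -/

section Local

variable {𝒳 : Type*} {d m : ℕ}

/-- `κ` as a function of `γ`. -/
noncomputable def kapOf (alg : FLAlgorithm) (γ : ℝ) : ℝ :=
  match alg with
  | .fedAvg s => γ * s / (1 - (1 - γ) ^ s)
  | .fedProx => 1 + γ

lemma one_sub_pow_eq (γ : ℝ) (s : ℕ) :
    1 - (1 - γ) ^ s = γ * ∑ τ ∈ Finset.range s, (1 - γ) ^ τ := by
  have := mul_neg_geom_sum (1 - γ) s
  rw [sub_sub_cancel] at this
  exact this.symm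

lemma geom_sum_le_nat {a : ℝ} (h0 : 0 ≤ a) (h1 : a ≤ 1) (s : ℕ) :
    ∑ τ ∈ Finset.range s, a ^ τ ≤ s :=
  calc ∑ τ ∈ Finset.range s, a ^ τ ≤ ∑ _τ ∈ Finset.range s, (1 : ℝ) :=
        Finset.sum_le_sum fun τ _ => pow_le_one₀ h0 h1
    _ = s := by simp

/-- For γ > 0 this is an equality, the reason for the shape of κ. At γ = 0 the convention 0/0 = 0
makes both κ and the left side vanish. -/
lemma steps_div_kapOf_fedAvg {γ : ℝ} (hγ : 0 ≤ γ) (hγ1 : γ < 1) (s : ℕ) :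
    (s : ℝ) / kapOf (.fedAvg s) γ ≤ ∑ τ ∈ Finset.range s, (1 - γ) ^ τ := by
  have hpos : 0 ≤ ∑ τ ∈ Finset.range s, (1 - γ) ^ τ :=
    Finset.sum_nonneg fun τ _ => pow_nonneg (by linarith) τ
  rcases s.eq_zero_or_pos with rfl | hs
  · simp
  rcases hγ.eq_or_lt with rfl | hγ
  · simp [kapOf]
  · have hs' : (s : ℝ) ≠ 0 := by positivity
    rw [kapOf, one_sub_pow_eq, mul_div_mul_left _ _ hγ.ne', div_div_cancel₀ hs']

/-- For FedAvg, κ is s divided by a sum of s powers that are at most 1. Strict positivity of γ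
excludes the junk value 0/0 = 0. -/
lemma one_le_kapOf {alg : FLAlgorithm} {γ : ℝ} (hs : 1 ≤ alg.steps) (hγ : 0 < γ)
    (hγ1 : (∃ s, alg = .fedAvg s) → γ < 1) : 1 ≤ kapOf alg γ := by
  cases alg with
  | fedAvg s =>
    have h1 : γ < 1 := hγ1 ⟨s, rfl⟩
    have hs : 0 < s := hs
    have hpos : 0 < ∑ τ ∈ Finset.range s, (1 - γ) ^ τ :=
      Finset.sum_pos (fun τ _ => pow_pos (by linarith) τ) ⟨0, by simpa using hs⟩
    rw [kapOf, one_sub_pow_eq, mul_div_mul_left _ _ hγ.ne', le_div_iff₀ hpos, one_mul]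
    exact geom_sum_le_nat (by linarith) (by linarith) s
  | fedProx => simp [kapOf, hγ.le]

lemma ringInverse_apply_of_eq_smul {T : Coef d →L[ℝ] Coef d} (hT : IsUnit T) {v : Coef d} {c : ℝ}
    (hc : c ≠ 0) (h : T v = c • v) : Ring.inverse T v = c⁻¹ • v := by
  have h1 := congrArg (fun S : Coef d →L[ℝ] Coef d => S v) (Ring.inverse_mul_cancel _ hT)
  simp only [mul_apply_eq_comp, h, map_smul,
    one_apply_eq_self] at h1
  rw [eq_inv_smul_iff₀ hc, h1]

/-- Joint diagonalization of `covOp`, `psiOp` and `localOp`. -/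
lemma exists_local_basis {alg : FLAlgorithm} {η γ : ℝ} (hη : 0 < η) (φ : 𝒳 → Coef d)
    (x : Fin m → 𝒳) (hγ : η * ‖Matrix.toEuclideanCLM (𝕜 := ℝ) (gram φ x)‖ ≤ γ)
    (hγ1 : (∃ s, alg = .fedAvg s) → γ < 1) :
    ∃ (b : OrthonormalBasis (Fin d) ℝ (Coef d)) (lam p : Fin d → ℝ),
      (∀ k, covOp φ x (b k) = lam k • b k) ∧ (∀ k, psiOp alg η φ x (b k) = p k • b k) ∧
      (∀ k, localOp alg η φ x (b k) = (1 - η * p k * lam k) • b k) ∧ (∀ k, 0 ≤ lam k) ∧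
      (∀ k, (alg.steps : ℝ) / kapOf alg γ ≤ p k) ∧ (∀ k, 0 ≤ p k) ∧ (∀ k, p k ≤ alg.steps) ∧
      ∀ k, 0 ≤ 1 - η * p k * lam k := by
  obtain ⟨b, lam, hb, h0, hle⟩ := exists_covOp_basis φ x
  have hγ' : ∀ k, η * lam k ≤ γ := fun k => (mul_le_mul_of_nonneg_left (hle k) hη.le).trans hγ
  have h0' : ∀ k, 0 ≤ η * lam k := fun k => mul_nonneg hη.le (h0 k)
  have hloc : ∀ (p : Fin d → ℝ), (∀ k, psiOp alg η φ x (b k) = p k • b k) →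
      ∀ k, localOp alg η φ x (b k) = (1 - η * p k * lam k) • b k := fun p hp k => by
    have h := congrArg (fun T : Coef d →L[ℝ] Coef d => T (b k))
      (psiOp_mul_covOp (alg := alg) hη φ x)
    simp only [smul_apply, mul_apply_eq_comp,
      sub_apply, one_apply_eq_self, hb, map_smul, hp] at h
    rw [eq_sub_iff_add_eq, add_comm, ← eq_sub_iff_add_eq] at h
    rw [h, sub_smul, one_smul, smul_smul, smul_smul]
    congr 2
    ring
  cases alg with
  | fedAvg s =>
    have h1 : γ < 1 := hγ1 ⟨s, rfl⟩
    have hp : ∀ k, psiOp (.fedAvg s) η φ x (b k)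
        = (∑ τ ∈ Finset.range s, (1 - η * lam k) ^ τ) • b k := fun k => by
      simp only [psiOp, sum_apply, Finset.sum_smul]
      refine Finset.sum_congr rfl fun τ _ => pow_apply_of_eq_smul ?_ τ
      simp [hb, sub_smul, smul_smul]
    refine ⟨b, lam, _, hb, hp, hloc _ hp, h0, fun k => ?_, fun k => ?_, fun k => ?_, fun k => ?_⟩
    · refine (steps_div_kapOf_fedAvg ((h0' k).trans (hγ' k)) h1 s).trans ?_
      refine Finset.sum_le_sum fun τ _ => pow_le_pow_left₀ (by linarith) ?_ τ
      linarith [hγ' k]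
    · exact Finset.sum_nonneg fun τ _ => pow_nonneg (by linarith [hγ' k]) τ
    · exact geom_sum_le_nat (by linarith [hγ' k]) (by linarith [h0' k]) s
    · have := one_sub_pow_eq (η * lam k) s
      have hpw : 0 ≤ (1 - η * lam k) ^ s := pow_nonneg (by linarith [hγ' k]) s
      rw [mul_right_comm]
      linarith
  | fedProx =>
    have hpos : ∀ k, 0 < 1 + η * lam k := fun k => by linarith [h0' k]
    have hp : ∀ k, psiOp .fedProx η φ x (b k) = (1 + η * lam k)⁻¹ • b k := fun k => by
      refine ringInverse_apply_of_eq_smul (isUnit_one_add_covOp hη φ x) (hpos k).ne' ?_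
      simp [hb, add_smul, smul_smul]
    refine ⟨b, lam, _, hb, hp, hloc _ hp, h0, fun k => ?_, fun k => ?_, fun k => ?_, fun k => ?_⟩
    · simp only [FLAlgorithm.steps, kapOf, Nat.cast_one, one_div]
      exact inv_anti₀ (hpos k) (by linarith [hγ' k])
    · exact inv_nonneg.2 (hpos k).le
    · simpa [FLAlgorithm.steps] using inv_le_one_of_one_le₀ (by linarith [h0' k])
    · have : 1 - η * (1 + η * lam k)⁻¹ * lam k = (1 + η * lam k)⁻¹ := by
        have := (hpos k).ne'
        field_simp
        ring
      rw [this]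
      exact inv_nonneg.2 (hpos k).le

/-- Quadratic-form bounds for a client's contribution to the round operator. -/
structure LocalBounds (alg : FLAlgorithm) (η γ : ℝ) (φ : 𝒳 → Coef d) (x : Fin m → 𝒳) : Prop where
  symm : ∀ u v, inner ℝ (localOp alg η φ x u) v = inner ℝ u (localOp alg η φ x v)
  nonneg : ∀ v, 0 ≤ inner ℝ v (localOp alg η φ x v)
  one_sub_nonneg : ∀ v, 0 ≤ inner ℝ v (v - localOp alg η φ x v)
  lower : ∀ v, η * (alg.steps / kapOf alg γ) * inner ℝ v (covOp φ x v)
    ≤ inner ℝ v (v - localOp alg η φ x v)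
  upper : ∀ v, inner ℝ v (v - localOp alg η φ x v)
    ≤ η * alg.steps * inner ℝ v (covOp φ x v)
  psi : ∀ v, ∑ j, (inner ℝ v (localPsi alg η φ x j) : ℝ) ^ 2
    ≤ η * alg.steps / m * inner ℝ v (v - localOp alg η φ x v)

/-- In the common eigenbasis I − L has eigenvalues ηpλ with s/κ ≤ p ≤ s, so each bound is a
comparison of coefficients. -/
lemma localBounds {alg : FLAlgorithm} {η γ : ℝ} (hη : 0 < η) (φ : 𝒳 → Coef d)
    (x : Fin m → 𝒳) (hγ : η * ‖Matrix.toEuclideanCLM (𝕜 := ℝ) (gram φ x)‖ ≤ γ)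
    (hγ1 : (∃ s, alg = .fedAvg s) → γ < 1) : LocalBounds alg η γ φ x := by
  obtain ⟨b, lam, p, hC, hP, hL, hlam, hpl, hp0, hps, hl⟩ :=
    exists_local_basis (alg := alg) hη φ x hγ hγ1
  have hL1 : ∀ k, (1 - localOp alg η φ x) (b k) = (η * p k * lam k) • b k := fun k => by
    rw [sub_apply, one_apply_eq_self, hL, sub_smul,
      one_smul, sub_sub_cancel]
  have hform : ∀ v, inner ℝ v (v - localOp alg η φ x v)
      = ∑ k, η * p k * lam k * (inner ℝ (b k) v * inner ℝ (b k) v) := fun v =>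
    inner_apply_of_diagonal b hL1 v v
  refine ⟨inner_apply_comm_of_diagonal b hL, fun v => ?_, fun v => ?_, fun v => ?_, fun v => ?_,
    fun v => ?_⟩
  · rw [inner_apply_of_diagonal b hL]
    exact Finset.sum_nonneg fun k _ => mul_nonneg (hl k) (mul_self_nonneg _)
  · rw [hform]
    exact Finset.sum_nonneg fun k _ => mul_nonneg
      (mul_nonneg (mul_nonneg hη.le (hp0 k)) (hlam k)) (mul_self_nonneg _)
  · rw [hform, inner_apply_of_diagonal b hC, Finset.mul_sum]
    refine Finset.sum_le_sum fun k _ => ?_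
    rw [← mul_assoc]
    refine mul_le_mul_of_nonneg_right ?_ (mul_self_nonneg (inner ℝ (b k) v))
    exact mul_le_mul_of_nonneg_right (mul_le_mul_of_nonneg_left (hpl k) hη.le) (hlam k)
  · rw [hform, inner_apply_of_diagonal b hC, Finset.mul_sum]
    refine Finset.sum_le_sum fun k _ => ?_
    rw [← mul_assoc (η * (alg.steps : ℝ))]
    refine mul_le_mul_of_nonneg_right ?_ (mul_self_nonneg (inner ℝ (b k) v))
    exact mul_le_mul_of_nonneg_right (mul_le_mul_of_nonneg_left (hps k) hη.le) (hlam k)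
  · rw [sum_inner_localPsi_sq _ _ _ _ (inner_apply_comm_of_diagonal b hP), hform,
      inner_apply_of_diagonal b hC, Finset.mul_sum, Finset.mul_sum]
    refine Finset.sum_le_sum fun k _ => ?_
    rw [inner_basis_apply_of_diagonal b hP]
    have h1 : 0 ≤ η ^ 2 / m * (p k * lam k * (inner ℝ (b k) v * inner ℝ (b k) v)) :=
      mul_nonneg (by positivity : (0:ℝ) ≤ η ^ 2 / m) (mul_nonneg (mul_nonneg (hp0 k) (hlam k))
        (mul_self_nonneg (inner ℝ (b k) v)))
    -- One of the two factors p from P C P is bounded by s; the other turns η²pλ into η times the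
    -- eigenvalue of I − L.
    calc _ = (η ^ 2 / m * (p k * lam k * (inner ℝ (b k) v * inner ℝ (b k) v))) * p k := by ring
      _ ≤ (η ^ 2 / m * (p k * lam k * (inner ℝ (b k) v * inner ℝ (b k) v))) * alg.steps :=
        mul_le_mul_of_nonneg_left (hps k) h1
      _ = _ := by ring

lemma hasGradientAt_localRisk (φ : 𝒳 → Coef d) (x : Fin m → 𝒳) (y : Fin m → ℝ) (θ : Coef d) :
    HasGradientAt (localRisk φ x y)
      (covOp φ x θ - (1 / (m : ℝ)) • ∑ j, y j • φ (x j)) θ := by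
  rw [hasGradientAt_iff_hasFDerivAt]
  have h1 : ∀ j, HasFDerivAt (fun θ : Coef d => (modelValue φ θ (x j) - y j) ^ 2)
      ((2 * (modelValue φ θ (x j) - y j)) • innerSL ℝ (φ (x j))) θ := fun j => by
    have h := ((innerSL ℝ (φ (x j))).hasFDerivAt (x := θ)).sub_const (y j)
    have h2 := h.pow 2
    simp only [nsmul_eq_mul, Nat.cast_ofNat, Nat.add_one_sub_one, pow_one] at h2
    exact h2
  have h2 := (HasFDerivAt.fun_sum (u := Finset.univ) fun j _ => h1 j).const_mul (1 / (2 * (m : ℝ)))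
  refine h2.congr_fderiv ?_
  ext v
  simp only [smul_apply, sum_apply, innerSL_apply_apply,
    InnerProductSpace.toDual_apply_apply, smul_eq_mul, covOp_apply, ← smul_sub,
    ← Finset.sum_sub_distrib, ← sub_smul, inner_smul_left, sum_inner, Finset.mul_sum, modelValue]
  refine Finset.sum_congr rfl fun j _ => ?_
  simp
  ring

lemma iterate_affine (T : Coef d →L[ℝ] Coef d) (c θ : Coef d) (s : ℕ) :
    (fun ϑ => T ϑ + c)^[s] θ = (T ^ s) θ + (∑ τ ∈ Finset.range s, T ^ τ) c := by
  induction s with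
  | zero => simp
  | succ s ih =>
    rw [Function.iterate_succ_apply', ih, map_add, Finset.sum_range_succ', pow_succ']
    simp only [add_apply, sum_apply, pow_succ', map_sum,
      mul_apply_eq_comp, pow_zero, one_apply_eq_self,
      add_assoc]

/-- Second-order expansion of the empirical risk. -/
lemma localRisk_add (φ : 𝒳 → Coef d) (x : Fin m → 𝒳) (y : Fin m → ℝ) (θ h : Coef d) :
    localRisk φ x y (θ + h) = localRisk φ x y θ
      + inner ℝ h (covOp φ x θ - (1 / (m : ℝ)) • ∑ j, y j • φ (x j))
      + 1 / 2 * inner ℝ h (covOp φ x h) := by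
  simp only [localRisk, inner_sub_right, inner_smul_right, inner_covOp, inner_sum, Finset.mul_sum,
    ← Finset.sum_sub_distrib, ← Finset.sum_add_distrib, modelValue, inner_add_right]
  refine Finset.sum_congr rfl fun j _ => ?_
  rw [real_inner_comm (φ (x j)) h]
  rcases eq_or_ne (m : ℝ) 0 with hm | hm
  · simp [hm]
  · field_simp
    ring

lemma sum_smul_localPsi_eq (alg : FLAlgorithm) (η : ℝ) (φ : 𝒳 → Coef d) (x : Fin m → 𝒳)
    (y : Fin m → ℝ) :
    ∑ j, y j • localPsi alg η φ x j
      = psiOp alg η φ x (η • (1 / (m : ℝ)) • ∑ j, y j • φ (x j)) := by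
  rw [smul_smul, map_smul, map_sum, Finset.smul_sum]
  refine Finset.sum_congr rfl fun j _ => ?_
  rw [localPsi_eq, map_smul, smul_comm, mul_one_div]

/-- The risk is quadratic, so its gradient is affine and FedAvg iterates an affine map. For FedProx
the proximal objective is strictly convex and has a single minimizer, which solves a linear
equation. -/
lemma localUpdate_eq {alg : FLAlgorithm} {η : ℝ} (hη : 0 < η) (φ : 𝒳 → Coef d) (x : Fin m → 𝒳)
    (y : Fin m → ℝ) (θ : Coef d) :
    localUpdate alg η (localRisk φ x y) θ
      = localOp alg η φ x θ + ∑ j, y j • localPsi alg η φ x j := by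
  rw [sum_smul_localPsi_eq]
  set g : Coef d := (1 / (m : ℝ)) • ∑ j, y j • φ (x j) with hg
  cases alg with
  | fedAvg s =>
    have hstep : (fun ϑ => ϑ - η • gradient (localRisk φ x y) ϑ)
        = fun ϑ => (1 - η • covOp φ x) ϑ + η • g := by
      funext ϑ
      rw [(hasGradientAt_localRisk φ x y ϑ).gradient, smul_sub, sub_apply,
        one_apply_eq_self, smul_apply]
      abel
    rw [localUpdate, hstep, iterate_affine]
    rfl
  | fedProx =>
    set R := Ring.inverse (1 + η • covOp φ x) with hR
    have hstar : localOp .fedProx η φ x θ + psiOp .fedProx η φ x (η • g) = R (θ + η • g) := by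
      rw [map_add]; rfl
    rw [hstar]
    set ϑ₀ := R (θ + η • g) with hϑ₀
    have heq : ϑ₀ + η • covOp φ x ϑ₀ = θ + η • g := by
      have h := congrArg (fun S : Coef d →L[ℝ] Coef d => S (θ + η • g))
        (Ring.mul_inverse_cancel _ (isUnit_one_add_covOp hη φ x))
      simpa [hϑ₀, hR] using h
    set F : Coef d → ℝ := fun ϑ' => localRisk φ x y ϑ' + 1 / (2 * η) * ‖ϑ' - θ‖ ^ 2 with hF
    -- The linear term vanishes because ϑ₀ is stationary; the quadratic remainder yields both
    -- existence and uniqueness of the minimizer.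
    have hexp : ∀ h, F (ϑ₀ + h) = F ϑ₀ + (1 / 2 * inner ℝ h (covOp φ x h)
        + 1 / (2 * η) * ‖h‖ ^ 2) := fun h => by
      have hgrad : covOp φ x ϑ₀ - g = (1 / η) • (θ - ϑ₀) := by
        rw [one_div, eq_inv_smul_iff₀ hη.ne', smul_sub, sub_eq_sub_iff_add_eq_add, add_comm, heq]
      have hn : ‖ϑ₀ + h - θ‖ ^ 2 = ‖ϑ₀ - θ‖ ^ 2 + 2 * inner ℝ h (ϑ₀ - θ) + ‖h‖ ^ 2 := by
        rw [add_sub_right_comm, norm_add_sq_real, real_inner_comm]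
      simp only [hF, localRisk_add, ← hg, hgrad, hn, inner_smul_right]
      rw [← neg_sub ϑ₀ θ, inner_neg_right]
      field_simp
      ring
    have hmin : IsMinOn F Set.univ ϑ₀ := fun ϑ _ => by
      have h := hexp (ϑ - ϑ₀)
      rw [add_sub_cancel] at h
      have := inner_covOp_self_nonneg φ x (ϑ - ϑ₀)
      have h2 : 0 ≤ 1 / (2 * η) * ‖ϑ - ϑ₀‖ ^ 2 := by positivity
      change F ϑ₀ ≤ F ϑ
      rw [h]
      linarith
    -- Existence of a minimizer makes the choice by `Classical.epsilon` meaningful.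
    have hspec : IsMinOn F Set.univ (localUpdate .fedProx η (localRisk φ x y) θ) :=
      Classical.epsilon_spec (p := fun ϑ => IsMinOn F Set.univ ϑ) ⟨ϑ₀, hmin⟩
    set ϑ₁ := localUpdate .fedProx η (localRisk φ x y) θ
    have hle : F ϑ₁ ≤ F ϑ₀ := hspec (Set.mem_univ ϑ₀)
    have h := hexp (ϑ₁ - ϑ₀)
    rw [add_sub_cancel] at h
    have h1 := inner_covOp_self_nonneg φ x (ϑ₁ - ϑ₀)
    have h2 : 1 / (2 * η) * ‖ϑ₁ - ϑ₀‖ ^ 2 ≤ 0 := by linarith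
    have h3 : ‖ϑ₁ - ϑ₀‖ ^ 2 ≤ 0 := by
      by_contra hc
      push Not at hc
      have : 0 < 1 / (2 * η) * ‖ϑ₁ - ϑ₀‖ ^ 2 := by positivity
      linarith
    exact sub_eq_zero.mp (norm_eq_zero.mp
      ((pow_eq_zero_iff two_ne_zero).mp (le_antisymm h3 (sq_nonneg _))))

end Local

/-! ### The round operator: contraction, accumulated noise and bias -/

section Global

variable {𝒳 : Type*} {d M : ℕ} {n : Fin M → ℕ}

lemma kap_eq_kapOf (alg : FLAlgorithm) (η : ℝ) (φ : 𝒳 → Coef d) (x : ∀ i, Fin (n i) → 𝒳) :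
    kap alg η φ x = kapOf alg (gam η φ x) := by
  cases alg <;> rfl

lemma mul_norm_gram_le_gam {η : ℝ} (hη : 0 < η) (φ : 𝒳 → Coef d) (x : ∀ i, Fin (n i) → 𝒳)
    (i : Fin M) : η * ‖Matrix.toEuclideanCLM (𝕜 := ℝ) (gram φ (x i))‖ ≤ gam η φ x :=
  mul_le_mul_of_nonneg_left
    (le_ciSup (f := fun i => ‖Matrix.toEuclideanCLM (𝕜 := ℝ) (gram φ (x i))‖)
      (Set.finite_range _).bddAbove i) hη.le

lemma weight_nonneg (n : Fin M → ℕ) (i : Fin M) : 0 ≤ weight n i :=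
  div_nonneg (Nat.cast_nonneg _) (Nat.cast_nonneg _)

lemma sum_weight {n : Fin M → ℕ} (hN : 0 < total n) : ∑ i, weight n i = 1 := by
  have : (total n : ℝ) ≠ 0 := by positivity
  simp only [weight]
  rw [← Finset.sum_div, div_eq_one_iff_eq this, total, Nat.cast_sum]

lemma weight_div {n : Fin M → ℕ} (hn : ∀ i, 0 < n i) (i : Fin M) :
    weight n i / n i = 1 / (total n : ℝ) := by
  have : (n i : ℝ) ≠ 0 := by have := hn i; positivity
  rw [weight, div_right_comm, div_self this]

lemma sum_weight_inner_covOp (hn : ∀ i, 0 < n i) (φ : 𝒳 → Coef d) (x : ∀ i, Fin (n i) → 𝒳)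
    (v : Fin M → Coef d) :
    ∑ i, weight n i * inner ℝ (v i) (covOp φ (x i) (v i))
      = 1 / (total n : ℝ) * ∑ i, ∑ j, (inner ℝ (φ (x i j)) (v i) : ℝ) ^ 2 := by
  rw [Finset.mul_sum]
  refine Finset.sum_congr rfl fun i _ => ?_
  rw [inner_covOp_self, ← weight_div hn i]
  ring

lemma roundOp_apply (alg : FLAlgorithm) (η : ℝ) (φ : 𝒳 → Coef d) (x : ∀ i, Fin (n i) → 𝒳)
    (v : Coef d) : roundOp alg η φ x v = ∑ i, weight n i • localOp alg η φ (x i) v := by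
  simp [roundOp, sum_apply]

lemma sub_roundOp_apply (hN : 0 < total n) (alg : FLAlgorithm) (η : ℝ) (φ : 𝒳 → Coef d)
    (x : ∀ i, Fin (n i) → 𝒳) (v : Coef d) :
    v - roundOp alg η φ x v = ∑ i, weight n i • (v - localOp alg η φ (x i) v) := by
  simp_rw [roundOp_apply, smul_sub, Finset.sum_sub_distrib, ← Finset.sum_smul, sum_weight hN,
    one_smul]

lemma inner_sub_roundOp (hN : 0 < total n) (alg : FLAlgorithm) (η : ℝ) (φ : 𝒳 → Coef d)
    (x : ∀ i, Fin (n i) → 𝒳) (v : Coef d) :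
    inner ℝ v (v - roundOp alg η φ x v)
      = ∑ i, weight n i * inner ℝ v (v - localOp alg η φ (x i) v) := by
  simp_rw [sub_roundOp_apply hN, inner_sum, inner_smul_right]

/-- The pooled empirical covariance is bounded below by `a`. -/
def PooledLower (a : ℝ) (φ : 𝒳 → Coef d) (x : ∀ i, Fin (n i) → 𝒳) : Prop :=
  ∀ v : Coef d, a * ‖v‖ ^ 2 ≤ 1 / (total n : ℝ) * ∑ i, ∑ j, (inner ℝ (φ (x i j)) v : ℝ) ^ 2

/-- If γ ≤ 0, all Gram matrices vanish and so do the covariances, against the pooled lower bound at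
a unit vector; such a vector exists as d > 0. -/
lemma gam_pos {η a : ℝ} (hη : 0 < η) (ha : 0 < a) (hd : 0 < d) (hn : ∀ i, 0 < n i)
    {φ : 𝒳 → Coef d} {x : ∀ i, Fin (n i) → 𝒳} (h : PooledLower a φ x) : 0 < gam η φ x := by
  by_contra hc
  push Not at hc
  have hG : ∀ i, ‖Matrix.toEuclideanCLM (𝕜 := ℝ) (gram φ (x i))‖ ≤ 0 := fun i => by
    have := (mul_norm_gram_le_gam hη φ x i).trans hc
    exact nonpos_of_mul_nonpos_right this hη
  have : NeZero d := ⟨hd.ne'⟩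
  set v : Coef d := EuclideanSpace.single 0 1 with hv
  have hv1 : ‖v‖ = 1 := by simp [hv]
  have h0 : ∀ i, covOp φ (x i) v = 0 := fun i => by
    have h1 := (norm_covOp_sq_le φ (x i) v).trans
      (mul_nonpos_of_nonpos_of_nonneg (hG i) (inner_covOp_self_nonneg φ (x i) v))
    exact norm_eq_zero.mp ((pow_eq_zero_iff two_ne_zero).mp (le_antisymm h1 (sq_nonneg _)))
  have h2 := h v
  rw [← sum_weight_inner_covOp hn φ x fun _ => v] at h2
  simp only [h0, inner_zero_right, mul_zero, Finset.sum_const_zero, hv1] at h2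
  linarith

/-- Quadratic-form bounds for the round operator, with contraction rate `r`. -/
structure RoundBounds (alg : FLAlgorithm) (η r : ℝ) (φ : 𝒳 → Coef d)
    (x : ∀ i, Fin (n i) → 𝒳) : Prop where
  loc : ∀ i, LocalBounds alg η (gam η φ x) φ (x i)
  symm : ∀ u v, inner ℝ (roundOp alg η φ x u) v = inner ℝ u (roundOp alg η φ x v)
  nonneg : ∀ v, 0 ≤ inner ℝ v (roundOp alg η φ x v)
  lower : ∀ v, r * ‖v‖ ^ 2 ≤ inner ℝ v (v - roundOp alg η φ x v)
  psi : ∀ v, ∑ i, ∑ j, (weight n i * inner ℝ v (localPsi alg η φ (x i) j)) ^ 2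
    ≤ η * alg.steps / total n * inner ℝ v (v - roundOp alg η φ x v)

/-- Weighted averages of the local bounds. In the noise bound w_i²/n_i = w_i/N turns the local 1/n_i
into 1/N. -/
lemma roundBounds {alg : FLAlgorithm} {η a : ℝ} (hη : 0 < η) (hn : ∀ i, 0 < n i)
    (hN : 0 < total n) {φ : 𝒳 → Coef d} {x : ∀ i, Fin (n i) → 𝒳} (h : PooledLower a φ x)
    (hκ : 0 < kap alg η φ x)
    (hγ1 : (∃ s, alg = .fedAvg s) → gam η φ x < 1) :
    RoundBounds alg η (η * (alg.steps / kap alg η φ x) * a) φ x := by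
  have hloc : ∀ i, LocalBounds alg η (gam η φ x) φ (x i) := fun i =>
    localBounds hη φ (x i) (mul_norm_gram_le_gam hη φ x i) hγ1
  refine ⟨hloc, fun u v => ?_, fun v => ?_, fun v => ?_, fun v => ?_⟩
  · simp_rw [roundOp_apply, sum_inner, inner_sum, inner_smul_left, inner_smul_right, (hloc _).symm]
    simp
  · simp_rw [roundOp_apply, inner_sum, inner_smul_right]
    exact Finset.sum_nonneg fun i _ => mul_nonneg (weight_nonneg n i) ((hloc i).nonneg v)
  · rw [inner_sub_roundOp hN, mul_assoc]
    have hc : 0 ≤ η * (alg.steps / kap alg η φ x) := by positivity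
    refine (mul_le_mul_of_nonneg_left (h v) hc).trans ?_
    rw [← sum_weight_inner_covOp hn φ x fun _ => v, Finset.mul_sum]
    refine Finset.sum_le_sum fun i _ => ?_
    rw [mul_left_comm, kap_eq_kapOf]
    exact mul_le_mul_of_nonneg_left ((hloc i).lower v) (weight_nonneg n i)
  · rw [inner_sub_roundOp hN, Finset.mul_sum]
    refine Finset.sum_le_sum fun i _ => ?_
    simp_rw [mul_pow]
    rw [← Finset.mul_sum]
    refine (mul_le_mul_of_nonneg_left ((hloc i).psi v) (sq_nonneg _)).trans (le_of_eq ?_)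
    have := weight_div hn i
    calc _ = η * alg.steps * (weight n i / n i) * weight n i
          * inner ℝ v (v - localOp alg η φ (x i) v) := by ring
      _ = _ := by rw [this]; ring

lemma RoundBounds.isUnit {alg : FLAlgorithm} {η r : ℝ} (hr : 0 < r) {φ : 𝒳 → Coef d}
    {x : ∀ i, Fin (n i) → 𝒳} (h : RoundBounds alg η r φ x) : IsUnit (1 - roundOp alg η φ x) :=
  isUnit_of_inner_ge hr h.lower

lemma RoundBounds.exists_basis {alg : FLAlgorithm} {η r : ℝ} {φ : 𝒳 → Coef d}
    {x : ∀ i, Fin (n i) → 𝒳} (h : RoundBounds alg η r φ x) :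
    ∃ (b : OrthonormalBasis (Fin d) ℝ (Coef d)) (l : Fin d → ℝ),
      (∀ k, roundOp alg η φ x (b k) = l k • b k) ∧ (∀ k, 0 ≤ l k) ∧ ∀ k, l k ≤ 1 - r := by
  obtain ⟨b, l, hb⟩ := exists_diagonal_basis h.symm
  have hb1 : ∀ k, inner ℝ (b k) (b k) = (1 : ℝ) := fun k => by
    rw [real_inner_self_eq_norm_sq, b.norm_eq_one]; simp
  refine ⟨b, l, hb, fun k => ?_, fun k => ?_⟩
  · have := h.nonneg (b k)
    rwa [hb, inner_smul_right, hb1, mul_one] at this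
  · have := h.lower (b k)
    rw [hb, inner_sub_right, inner_smul_right, hb1, b.norm_eq_one] at this
    linarith

lemma RoundBounds.norm_pow_sq_le {alg : FLAlgorithm} {η r : ℝ} {φ : 𝒳 → Coef d}
    {x : ∀ i, Fin (n i) → 𝒳} (h : RoundBounds alg η r φ x) (t : ℕ) (v : Coef d) :
    ‖(roundOp alg η φ x ^ t) v‖ ^ 2 ≤ (1 - r) ^ (2 * t) * ‖v‖ ^ 2 := by
  obtain ⟨b, l, hb, h0, h1⟩ := h.exists_basis
  rw [mul_comm 2 t, pow_mul]
  exact norm_apply_sq_le_of_diagonal b (fun k => pow_apply_of_eq_smul (hb k) t)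
    (fun k => pow_nonneg (h0 k) t) (fun k => pow_le_pow_left₀ (h0 k) (h1 k) t) v

/-- The operator `∑_{τ<t} 𝓛^τ` that accumulates the noise of `t` rounds. -/
noncomputable def accumOp (alg : FLAlgorithm) (η : ℝ) (φ : 𝒳 → Coef d)
    (x : ∀ i, Fin (n i) → 𝒳) (t : ℕ) : Coef d →L[ℝ] Coef d :=
  ∑ τ ∈ Finset.range t, roundOp alg η φ x ^ τ

lemma RoundBounds.sum_norm_accumOp_sq_le {alg : FLAlgorithm} {η r : ℝ} (hη : 0 < η)
    (hr : 0 < r) {φ : 𝒳 → Coef d}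
    {x : ∀ i, Fin (n i) → 𝒳} (h : RoundBounds alg η r φ x) (t : ℕ) :
    ∑ i, ∑ j, ‖accumOp alg η φ x t (weight n i • localPsi alg η φ (x i) j)‖ ^ 2
      ≤ η * alg.steps / total n * (d / r) := by
  obtain ⟨b, l, hb, h0, h1⟩ := h.exists_basis
  have hA : ∀ k, accumOp alg η φ x t (b k) = (∑ τ ∈ Finset.range t, l k ^ τ) • b k := fun k => by
    simp only [accumOp, sum_apply, Finset.sum_smul]
    exact Finset.sum_congr rfl fun τ _ => pow_apply_of_eq_smul (hb k) τ
  have hexp : ∑ i, ∑ j, ‖accumOp alg η φ x t (weight n i • localPsi alg η φ (x i) j)‖ ^ 2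
      = ∑ k, (∑ τ ∈ Finset.range t, l k ^ τ) ^ 2
        * ∑ i, ∑ j, (weight n i * inner ℝ (b k) (localPsi alg η φ (x i) j)) ^ 2 := by
    simp_rw [norm_sq_eq_sum_inner_sq b, inner_basis_apply_of_diagonal b hA, inner_smul_right,
      mul_pow _ (_ * _), Finset.mul_sum]
    rw [Finset.sum_comm]
    simp_rw [Finset.sum_comm (s := (Finset.univ : Finset (Fin (n _))))]
  rw [hexp]
  have hterm : ∀ k, (∑ τ ∈ Finset.range t, l k ^ τ) ^ 2
        * ∑ i, ∑ j, (weight n i * inner ℝ (b k) (localPsi alg η φ (x i) j)) ^ 2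
      ≤ η * alg.steps / total n * (1 / r) := fun k => by
    set a := ∑ τ ∈ Finset.range t, l k ^ τ with ha
    have hform : inner ℝ (b k) (b k - roundOp alg η φ x (b k)) = 1 - l k := by
      rw [hb, inner_sub_right, inner_smul_right, real_inner_self_eq_norm_sq, b.norm_eq_one]
      ring
    have hpsi := h.psi (b k)
    rw [hform] at hpsi
    have hc : 0 ≤ η * alg.steps / (total n : ℝ) := by positivity
    have ha0 : 0 ≤ a := Finset.sum_nonneg fun τ _ => pow_nonneg (h0 k) τ
    have ha1 : a * (1 - l k) ≤ 1 := by
      rw [ha, geom_sum_mul_neg]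
      linarith [pow_nonneg (h0 k) t]
    have ha2 : 0 ≤ a * (1 - l k) := mul_nonneg ha0 (by linarith [h1 k])
    -- Since a(1 − l) = 1 − l^t lies in [0, 1] and r ≤ 1 − l, replacing r by 1 − l produces the
    -- square of a quantity at most 1.
    have hkey : a ^ 2 * (1 - l k) ≤ 1 / r := by
      rw [le_div_iff₀ hr]
      calc a ^ 2 * (1 - l k) * r = a * (a * (1 - l k)) * r := by ring
        _ ≤ a * (a * (1 - l k)) * (1 - l k) :=
          mul_le_mul_of_nonneg_left (by linarith [h1 k]) (mul_nonneg ha0 ha2)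
        _ = (a * (1 - l k)) ^ 2 := by ring
        _ ≤ 1 := pow_le_one₀ ha2 ha1
    calc _ ≤ a ^ 2 * (η * alg.steps / total n * (1 - l k)) :=
          mul_le_mul_of_nonneg_left hpsi (sq_nonneg a)
      _ = η * alg.steps / total n * (a ^ 2 * (1 - l k)) := by ring
      _ ≤ _ := mul_le_mul_of_nonneg_left hkey hc
  refine (Finset.sum_le_sum fun k _ => hterm k).trans (le_of_eq ?_)
  rw [Finset.sum_const, Finset.card_univ, Fintype.card_fin, nsmul_eq_mul]
  ring

lemma globalModel_succ {alg : FLAlgorithm} {η : ℝ} (hη : 0 < η) (φ : 𝒳 → Coef d)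
    (x : ∀ i, Fin (n i) → 𝒳) (y : ∀ i, Fin (n i) → ℝ) (θ₀ : Coef d) (t : ℕ) :
    globalModel alg η φ x y θ₀ (t + 1)
      = roundOp alg η φ x (globalModel alg η φ x y θ₀ t) + dotPsi alg η φ x y := by
  simp only [globalModel, localUpdate_eq hη, smul_add, Finset.sum_add_distrib, roundOp_apply,
    dotPsi, Finset.smul_sum]
  congr 1
  exact Finset.sum_congr rfl fun i _ => Finset.sum_congr rfl fun j _ => smul_comm _ _ _

lemma dotPsi_response (alg : FLAlgorithm) (η : ℝ) (φ : 𝒳 → Coef d) (x : ∀ i, Fin (n i) → 𝒳)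
    (θs : Fin M → Coef d) (z : ∀ i, Fin (n i) → ℝ) :
    dotPsi alg η φ x (response φ x θs z)
      = dotPsi alg η φ x (fun i j => modelValue φ (θs i) (x i j)) + dotPsi alg η φ x z := by
  simp only [dotPsi, response, add_smul, Finset.sum_add_distrib]

lemma thetaBar_sub {alg : FLAlgorithm} {η : ℝ} {φ : 𝒳 → Coef d} {x : ∀ i, Fin (n i) → 𝒳}
    (hu : IsUnit (1 - roundOp alg η φ x)) (θs : Fin M → Coef d) :
    thetaBar alg η φ x θs - roundOp alg η φ x (thetaBar alg η φ x θs)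
      = dotPsi alg η φ x fun i j => modelValue φ (θs i) (x i j) := by
  have h := congrArg (fun T : Coef d →L[ℝ] Coef d =>
    T (dotPsi alg η φ x fun i j => modelValue φ (θs i) (x i j))) (Ring.mul_inverse_cancel _ hu)
  exact h

/-- θ̄ is the fixed point of the noiseless round, so the error obeys an affine recursion driven by
the noise alone, which is unrolled. -/
lemma globalModel_sub_thetaBar {alg : FLAlgorithm} {η : ℝ} (hη : 0 < η) {φ : 𝒳 → Coef d}
    {x : ∀ i, Fin (n i) → 𝒳} (hu : IsUnit (1 - roundOp alg η φ x)) (θs : Fin M → Coef d)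
    (z : ∀ i, Fin (n i) → ℝ) (θ₀ : Coef d) (t : ℕ) :
    globalModel alg η φ x (response φ x θs z) θ₀ t - thetaBar alg η φ x θs
      = (roundOp alg η φ x ^ t) (θ₀ - thetaBar alg η φ x θs)
        + accumOp alg η φ x t (dotPsi alg η φ x z) := by
  have h := thetaBar_sub hu θs
  have hstep : ∀ t, globalModel alg η φ x (response φ x θs z) θ₀ (t + 1) - thetaBar alg η φ x θs
      = roundOp alg η φ x (globalModel alg η φ x (response φ x θs z) θ₀ t - thetaBar alg η φ x θs)
        + dotPsi alg η φ x z := fun t => by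
    rw [globalModel_succ hη, dotPsi_response, ← h, map_sub]
    abel
  rw [accumOp, ← iterate_affine]
  induction t with
  | zero => rfl
  | succ t ih => rw [hstep, ih, Function.iterate_succ_apply']

/-- Distance from the limit to a reference coefficient, in terms of the model discrepancies seen
through the features. -/
lemma RoundBounds.norm_thetaBar_sub_sq_le {alg : FLAlgorithm} {η r : ℝ} (hη : 0 < η) (hr : 0 < r)
    (hn : ∀ i, 0 < n i) (hN : 0 < total n) {φ : 𝒳 → Coef d}
    {x : ∀ i, Fin (n i) → 𝒳} (h : RoundBounds alg η r φ x) (θs : Fin M → Coef d) (θ : Coef d)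
    {D : ℝ} (hD : ∑ i, ∑ j, (inner ℝ (φ (x i j)) (θs i - θ) : ℝ) ^ 2 ≤ total n * D) :
    r * ‖thetaBar alg η φ x θs - θ‖ ^ 2 ≤ η * alg.steps * D := by
  set v := thetaBar alg η φ x θs - θ with hv
  -- Both θ̄ and θ are written through (I − L_i), so only the differences θ*_i − θ remain.
  have hB : v - roundOp alg η φ x v
      = ∑ i, weight n i • ((θs i - θ) - localOp alg η φ (x i) (θs i - θ)) := by
    have h1 : ∀ i, (θs i - θ) - localOp alg η φ (x i) (θs i - θ)
        = (θs i - localOp alg η φ (x i) (θs i)) - (θ - localOp alg η φ (x i) θ) := fun i => by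
      rw [map_sub]; abel
    simp_rw [h1, smul_sub _ (_ - _), Finset.sum_sub_distrib]
    rw [← sub_roundOp_apply hN alg η φ x θ]
    have h2 : dotPsi alg η φ x (fun i j => modelValue φ (θs i) (x i j))
        = ∑ i, weight n i • (θs i - localOp alg η φ (x i) (θs i)) := by
      simp only [dotPsi, ← sum_smul_localPsi hη, Finset.smul_sum]
      exact Finset.sum_congr rfl fun i _ => Finset.sum_congr rfl fun j _ => smul_comm _ _ _
    rw [← h2, ← thetaBar_sub (h.isUnit hr) θs, hv, map_sub]
    abel
  -- Cauchy–Schwarz in AM–GM form: expand the form I − L_i ⪰ 0 at v − δ.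
  have hcs : ∀ i, inner ℝ v ((θs i - θ) - localOp alg η φ (x i) (θs i - θ))
      ≤ 1 / 2 * inner ℝ v (v - localOp alg η φ (x i) v)
        + 1 / 2 * inner ℝ (θs i - θ) ((θs i - θ) - localOp alg η φ (x i) (θs i - θ)) := fun i => by
    set δ := θs i - θ
    have h1 := (h.loc i).one_sub_nonneg (v - δ)
    have h2 := (h.loc i).symm δ v
    rw [real_inner_comm] at h2
    simp only [map_sub, inner_sub_left, inner_sub_right] at h1 ⊢
    rw [real_inner_comm v δ] at h1
    linarith
  have h3 : inner ℝ v (v - roundOp alg η φ x v) ≤ η * alg.steps * D := by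
    -- After averaging, half of the left side reappears on the right and is absorbed.
    have h4 : inner ℝ v (v - roundOp alg η φ x v)
        ≤ 1 / 2 * inner ℝ v (v - roundOp alg η φ x v)
          + 1 / 2 * ∑ i, weight n i * inner ℝ (θs i - θ)
            ((θs i - θ) - localOp alg η φ (x i) (θs i - θ)) := by
      conv_lhs => rw [hB]
      rw [inner_sub_roundOp hN, inner_sum, Finset.mul_sum, Finset.mul_sum,
        ← Finset.sum_add_distrib]
      refine Finset.sum_le_sum fun i _ => ?_
      rw [inner_smul_right]
      refine (mul_le_mul_of_nonneg_left (hcs i) (weight_nonneg n i)).trans (le_of_eq ?_)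
      ring
    have h5 : ∑ i, weight n i * inner ℝ (θs i - θ)
          ((θs i - θ) - localOp alg η φ (x i) (θs i - θ))
        ≤ η * alg.steps * D := by
      calc _ ≤ ∑ i, weight n i * (η * alg.steps
              * inner ℝ (θs i - θ) (covOp φ (x i) (θs i - θ))) :=
            Finset.sum_le_sum fun i _ =>
              mul_le_mul_of_nonneg_left ((h.loc i).upper _) (weight_nonneg n i)
        _ = η * alg.steps * (1 / (total n : ℝ)
            * ∑ i, ∑ j, (inner ℝ (φ (x i j)) (θs i - θ) : ℝ) ^ 2) := by
          rw [← sum_weight_inner_covOp hn φ x fun i => θs i - θ, Finset.mul_sum]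
          exact Finset.sum_congr rfl fun i _ => mul_left_comm _ _ _
        _ ≤ η * alg.steps * D := by
          refine mul_le_mul_of_nonneg_left ?_ (by positivity)
          have hN' : (0 : ℝ) < total n := by exact_mod_cast hN
          rw [one_div, inv_mul_le_iff₀ hN']
          exact hD
    linarith
  exact (h.lower v).trans h3

end Global

/-! ### Mean squared error under independent noise -/

lemma integral_norm_add_sum_sq_le {Ω ι : Type*} [Fintype ι] [MeasurableSpace Ω]
    {ν : Measure Ω} [IsProbabilityMeasure ν] {d : ℕ} {Z : ι → Ω → ℝ} {σ : ℝ}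
    (hind : iIndepFun Z ν) (hmem : ∀ k, MemLp (Z k) 2 ν) (hmean : ∀ k, ∫ ω, Z k ω ∂ν = 0)
    (hvar : ∀ k, variance (Z k) ν ≤ σ ^ 2) (m : Coef d) (a : ι → Coef d) :
    Integrable (fun ω => ‖m + ∑ k, Z k ω • a k‖ ^ 2) ν ∧
      ∫ ω, ‖m + ∑ k, Z k ω • a k‖ ^ 2 ∂ν ≤ ‖m‖ ^ 2 + σ ^ 2 * ∑ k, ‖a k‖ ^ 2 := by
  classical
  have hexp : (fun ω => ‖m + ∑ k, Z k ω • a k‖ ^ 2) = fun ω =>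
      (‖m‖ ^ 2 + ∑ k, Z k ω * (2 * inner ℝ m (a k)))
        + ∑ k, ∑ l, Z k ω * Z l ω * inner ℝ (a k) (a l) := by
    funext ω
    rw [norm_add_sq_real, ← real_inner_self_eq_norm_sq (∑ k, Z k ω • a k), inner_sum, sum_inner,
      Finset.mul_sum]
    congr 1
    · congr 1
      refine Finset.sum_congr rfl fun k _ => ?_
      rw [inner_smul_right]; ring
    · refine Finset.sum_congr rfl fun k _ => ?_
      rw [inner_sum]
      refine Finset.sum_congr rfl fun l _ => ?_
      rw [inner_smul_right, inner_smul_left]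
      simp only [conj_trivial]
      ring
  have hint1 : ∀ k, Integrable (Z k) ν := fun k => (hmem k).integrable one_le_two
  have hint2 : ∀ k l, Integrable (fun ω => Z k ω * Z l ω) ν := fun k l =>
    (hmem k).integrable_mul (hmem l)
  have hI1 : Integrable (fun ω => ∑ k, Z k ω * (2 * inner ℝ m (a k))) ν :=
    integrable_finsetSum _ fun k _ => (hint1 k).mul_const _
  have hI2' : ∀ k, Integrable (fun ω => ∑ l, Z k ω * Z l ω * inner ℝ (a k) (a l)) ν := fun k =>
    integrable_finsetSum _ fun l _ => (hint2 k l).mul_const _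
  have hI2 : Integrable (fun ω => ∑ k, ∑ l, Z k ω * Z l ω * inner ℝ (a k) (a l)) ν :=
    integrable_finsetSum _ fun k _ => hI2' k
  have hI0 : Integrable (fun ω => ‖m‖ ^ 2 + ∑ k, Z k ω * (2 * inner ℝ m (a k))) ν :=
    (integrable_const _).add hI1
  rw [hexp]
  refine ⟨hI0.add hI2, ?_⟩
  -- Independence and zero means leave only the diagonal of the double sum.
  have hcross : ∀ k l, ∫ ω, Z k ω * Z l ω ∂ν = if k = l then variance (Z k) ν else 0 := by
    intro k l
    split_ifs with hkl
    · subst hkl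
      rw [variance_of_integral_eq_zero (hint1 k).aemeasurable (hmean k)]
      simp_rw [sq]
    · have := (hind.indepFun hkl).integral_mul_eq_mul_integral
        (hint1 k).aestronglyMeasurable (hint1 l).aestronglyMeasurable
      calc _ = (∫ ω, Z k ω ∂ν) * ∫ ω, Z l ω ∂ν := this
        _ = 0 := by rw [hmean, zero_mul]
  rw [integral_add hI0 hI2, integral_add (integrable_const _) hI1,
    integral_finsetSum _ fun k _ => (hint1 k).mul_const _, integral_finsetSum _ fun k _ => hI2' k]
  simp_rw [integral_finsetSum _ fun l _ => (hint2 _ l).mul_const _, integral_mul_const, hmean,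
    hcross]
  simp only [integral_const, probReal_univ, one_smul, zero_mul, Finset.sum_const_zero, add_zero,
    ite_mul, Finset.sum_ite_eq, Finset.mem_univ, if_true, real_inner_self_eq_norm_sq]
  rw [Finset.mul_sum]
  gcongr with k _
  exact hvar k

section Global

variable {𝒳 : Type*} {d M : ℕ} {n : Fin M → ℕ}

lemma map_dotPsi (T : Coef d →L[ℝ] Coef d) (alg : FLAlgorithm) (η : ℝ) (φ : 𝒳 → Coef d)
    (x : ∀ i, Fin (n i) → 𝒳) (z : ∀ i, Fin (n i) → ℝ) :
    T (dotPsi alg η φ x z)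
      = ∑ k : Σ i, Fin (n i), z k.1 k.2 • T (weight n k.1 • localPsi alg η φ (x k.1) k.2) := by
  rw [dotPsi, map_sum, Fintype.sum_sigma]
  simp_rw [map_sum, map_smul]

lemma RoundBounds.integral_error_le {alg : FLAlgorithm} {η r : ℝ} (hη : 0 < η) (hr : 0 < r)
    {φ : 𝒳 → Coef d} {x : ∀ i, Fin (n i) → 𝒳} (h : RoundBounds alg η r φ x)
    (θs : Fin M → Coef d) {σ : ℝ} {ν : Measure (∀ i, Fin (n i) → ℝ)} (hν : IsNoiseLaw σ ν)
    (θ₀ : Coef d) (t : ℕ) :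
    Integrable (fun z => ‖globalModel alg η φ x (response φ x θs z) θ₀ t
      - thetaBar alg η φ x θs‖ ^ 2) ν ∧
    ∫ z, ‖globalModel alg η φ x (response φ x θs z) θ₀ t - thetaBar alg η φ x θs‖ ^ 2 ∂ν
      ≤ (1 - r) ^ (2 * t) * ‖θ₀ - thetaBar alg η φ x θs‖ ^ 2
        + σ ^ 2 * (η * alg.steps / total n * (d / r)) := by
  have := hν.isProb
  simp_rw [globalModel_sub_thetaBar hη (h.isUnit hr), map_dotPsi]
  obtain ⟨hint, hle⟩ := integral_norm_add_sum_sq_le hν.indep (fun k => hν.memLp k.1 k.2)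
    (fun k => hν.mean k.1 k.2) (fun k => hν.var k.1 k.2)
    ((roundOp alg η φ x ^ t) (θ₀ - thetaBar alg η φ x θs))
    (fun k => accumOp alg η φ x t (weight n k.1 • localPsi alg η φ (x k.1) k.2))
  refine ⟨hint, hle.trans (add_le_add (h.norm_pow_sq_le t _)
    (mul_le_mul_of_nonneg_left ?_ (sq_nonneg σ)))⟩
  rw [Fintype.sum_sigma]
  exact h.sum_norm_accumOp_sq_le hη hr t

end Global

/-! ### Exponential moments and Chernoff bounds -/

lemma exp_neg_le_quadratic {x : ℝ} (hx : 0 ≤ x) : Real.exp (-x) ≤ 1 - x + x ^ 2 / 2 := by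
  have h1 := Real.quadratic_le_exp_of_nonneg hx
  have h2 : 0 < 1 - x + x ^ 2 / 2 := by nlinarith [sq_nonneg (x - 1)]
  rw [Real.exp_neg, inv_le_iff_one_le_mul₀ (Real.exp_pos x)]
  -- (1 + x + x²/2)(1 − x + x²/2) = 1 + x⁴/4 ≥ 1.
  nlinarith [mul_le_mul_of_nonneg_left h1 h2.le, sq_nonneg (x ^ 2)]

lemma integrable_and_integral_sq_le {Ω : Type*} [MeasurableSpace Ω] {μ : Measure Ω}
    {X : Ω → ℝ} (hX : Measurable X) (h0 : ∀ ω, 0 ≤ X ω)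
    {L : ℝ} (hL : 0 < L) (hint : Integrable (fun ω => Real.exp (X ω / L)) μ)
    (hle : ∫ ω, Real.exp (X ω / L) ∂μ ≤ 2) :
    Integrable X μ ∧ Integrable (fun ω => X ω ^ 2) μ ∧ ∫ ω, X ω ^ 2 ∂μ ≤ 4 * L ^ 2 := by
  have hpt : ∀ ω, X ω ≤ L * Real.exp (X ω / L) ∧
      X ω ^ 2 ≤ 2 * L ^ 2 * Real.exp (X ω / L) := fun ω => by
    have hq := Real.quadratic_le_exp_of_nonneg (div_nonneg (h0 ω) hL.le)
    have hx : 0 ≤ X ω / L := div_nonneg (h0 ω) hL.le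
    have hxe : X ω = L * (X ω / L) := by field_simp
    have h1 : X ω / L ≤ Real.exp (X ω / L) := by nlinarith [sq_nonneg (X ω / L)]
    have h2 : (X ω / L) ^ 2 ≤ 2 * Real.exp (X ω / L) := by nlinarith
    constructor
    · calc X ω = L * (X ω / L) := hxe
        _ ≤ _ := mul_le_mul_of_nonneg_left h1 hL.le
    · calc X ω ^ 2 = L ^ 2 * (X ω / L) ^ 2 := by rw [← mul_pow, ← hxe]
        _ ≤ L ^ 2 * (2 * Real.exp (X ω / L)) := mul_le_mul_of_nonneg_left h2 (sq_nonneg L)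
        _ = _ := by ring
  have hi1 : Integrable X μ := (hint.const_mul L).mono' hX.aestronglyMeasurable
    (ae_of_all _ fun ω => by rw [Real.norm_of_nonneg (h0 ω)]; exact (hpt ω).1)
  have hi2 : Integrable (fun ω => X ω ^ 2) μ :=
    (hint.const_mul (2 * L ^ 2)).mono' (hX.pow_const 2).aestronglyMeasurable
      (ae_of_all _ fun ω => by rw [Real.norm_of_nonneg (sq_nonneg _)]; exact (hpt ω).2)
  refine ⟨hi1, hi2, ?_⟩
  calc ∫ ω, X ω ^ 2 ∂μ ≤ ∫ ω, 2 * L ^ 2 * Real.exp (X ω / L) ∂μ :=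
        integral_mono hi2 (hint.const_mul _) fun ω => (hpt ω).2
    _ = 2 * L ^ 2 * ∫ ω, Real.exp (X ω / L) ∂μ := integral_const_mul _ _
    _ ≤ 2 * L ^ 2 * 2 := mul_le_mul_of_nonneg_left hle (by positivity)
    _ = 4 * L ^ 2 := by ring

section Tails

variable {Ω ι : Type*} [MeasurableSpace Ω] [Fintype ι] {μ : Measure Ω} [IsProbabilityMeasure μ]

/-- Upper tail of a sum of independent variables with `E exp(X/L) ≤ 2`. -/
lemma measureReal_sum_ge_le {X : ι → Ω → ℝ} (hX : ∀ k, Measurable (X k)) (hind : iIndepFun X μ)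
    {L : ℝ} (hL : 0 < L) (hint : ∀ k, Integrable (fun ω => Real.exp (X k ω / L)) μ)
    (hle : ∀ k, ∫ ω, Real.exp (X k ω / L) ∂μ ≤ 2) (c : ℝ) :
    μ.real {ω | Fintype.card ι * (L * (Real.log 2 + c)) ≤ ∑ k, X k ω}
      ≤ Real.exp (-(c * Fintype.card ι)) := by
  have hint' : ∀ k ∈ Finset.univ, Integrable (fun ω => Real.exp (1 / L * X k ω)) μ := fun k _ => by
    simpa [div_eq_inv_mul] using hint k
  have h := measure_ge_le_exp_mul_mgf (X := ∑ k, X k) (μ := μ) (t := 1 / L)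
    (Fintype.card ι * (L * (Real.log 2 + c))) (by positivity)
    (hind.integrable_exp_mul_sum hX hint')
  rw [hind.mgf_sum hX] at h
  simp only [Finset.sum_apply] at h
  refine h.trans ?_
  have hprod : ∏ k, mgf (X k) μ (1 / L) ≤ 2 ^ Fintype.card ι := by
    calc ∏ k, mgf (X k) μ (1 / L) ≤ ∏ _k : ι, (2 : ℝ) :=
          Finset.prod_le_prod (fun k _ => mgf_nonneg) fun k _ => by
            simpa [mgf, div_eq_inv_mul] using hle k
      _ = _ := by simp
  refine (mul_le_mul_of_nonneg_left hprod (Real.exp_pos _).le).trans (le_of_eq ?_)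
  have h2 : (2 : ℝ) ^ Fintype.card ι = Real.exp (Fintype.card ι * Real.log 2) := by
    rw [Real.exp_nat_mul, Real.exp_log two_pos]
  rw [h2, ← Real.exp_add]
  congr 1
  field_simp
  ring

/-- Lower tail of a sum of independent nonnegative variables with `E X ≥ a`, `E exp(X/L) ≤ 2`. -/
lemma measureReal_sum_le_le {X : ι → Ω → ℝ} (hX : ∀ k, Measurable (X k)) (hind : iIndepFun X μ)
    (h0 : ∀ k ω, 0 ≤ X k ω)
    {L a : ℝ} (hL : 0 < L) (ha : 0 < a) (hint : ∀ k, Integrable (fun ω => Real.exp (X k ω / L)) μ)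
    (hle : ∀ k, ∫ ω, Real.exp (X k ω / L) ∂μ ≤ 2) (hmean : ∀ k, a ≤ ∫ ω, X k ω ∂μ) :
    μ.real {ω | ∑ k, X k ω ≤ Fintype.card ι * (3 * a / 4)}
      ≤ Real.exp (-(a ^ 2 / (128 * L ^ 2) * Fintype.card ι)) := by
  -- This q minimizes the Chernoff exponent −qa/4 + 2q²L² per variable, with value −a²/(128L²).
  set q : ℝ := a / (16 * L ^ 2) with hq
  have hq0 : 0 < q := by positivity
  have hpt : ∀ k ω, Real.exp (-q * X k ω) ≤ 1 - q * X k ω + q ^ 2 / 2 * X k ω ^ 2 := fun k ω => by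
    have := exp_neg_le_quadratic (mul_nonneg hq0.le (h0 k ω))
    rw [neg_mul]
    linarith [mul_pow q (X k ω) 2]
  have hint' : ∀ k, Integrable (fun ω => Real.exp (-q * X k ω)) μ := fun k =>
    (integrable_const (1 : ℝ)).mono' ((hX k).const_mul _).exp.aestronglyMeasurable
      (ae_of_all _ fun ω => by
        rw [Real.norm_of_nonneg (Real.exp_pos _).le]
        exact Real.exp_le_one_iff.2 (mul_nonpos_of_nonpos_of_nonneg (by linarith) (h0 k ω)))
  have hmgf : ∀ k, mgf (X k) μ (-q) ≤ Real.exp (-q * a + 2 * q ^ 2 * L ^ 2) := fun k => by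
    obtain ⟨hi1, hi2, hsq⟩ := integrable_and_integral_sq_le (hX k) (h0 k) hL (hint k) (hle k)
    have hi3 : Integrable (fun ω => 1 - q * X k ω) μ := (integrable_const _).sub (hi1.const_mul q)
    calc mgf (X k) μ (-q) ≤ ∫ ω, (1 - q * X k ω) + q ^ 2 / 2 * X k ω ^ 2 ∂μ :=
          integral_mono (hint' k) (hi3.add (hi2.const_mul _)) (hpt k)
      _ = 1 - q * ∫ ω, X k ω ∂μ + q ^ 2 / 2 * ∫ ω, X k ω ^ 2 ∂μ := by
          rw [integral_add hi3 (hi2.const_mul _), integral_sub (integrable_const _)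
            (hi1.const_mul q), integral_const_mul, integral_const_mul]
          simp
      _ ≤ (-q * a + 2 * q ^ 2 * L ^ 2) + 1 := by
          have h1 := mul_le_mul_of_nonneg_left (hmean k) hq0.le
          have h2 := mul_le_mul_of_nonneg_left hsq (by positivity : (0 : ℝ) ≤ q ^ 2 / 2)
          linarith
      _ ≤ _ := Real.add_one_le_exp _
  have h := measure_le_le_exp_mul_mgf (X := ∑ k, X k) (μ := μ) (t := -q)
    (Fintype.card ι * (3 * a / 4)) (by linarith)
    (hind.integrable_exp_mul_sum hX fun k _ => hint' k)
  rw [hind.mgf_sum hX] at h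
  simp only [Finset.sum_apply] at h
  refine h.trans ?_
  have hprod : ∏ k, mgf (X k) μ (-q)
      ≤ Real.exp (Fintype.card ι * (-q * a + 2 * q ^ 2 * L ^ 2)) := by
    calc ∏ k, mgf (X k) μ (-q) ≤ ∏ _k : ι, Real.exp (-q * a + 2 * q ^ 2 * L ^ 2) :=
          Finset.prod_le_prod (fun k _ => mgf_nonneg) fun k _ => hmgf k
      _ = _ := by rw [Finset.prod_const, Finset.card_univ, Real.exp_nat_mul]
  refine (mul_le_mul_of_nonneg_left hprod (Real.exp_pos _).le).trans (le_of_eq ?_)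
  rw [← Real.exp_add]
  congr 1
  rw [hq]
  field_simp
  ring

variable {d : ℕ}

/-- Homogeneity passes from unit vectors to vectors of norm at most G, and finiteness of the lower
integral gives integrability. -/
lemma SubGaussianVec.integrable_exp {K : ℝ} {V : Ω → Coef d}
    (hV : Measurable V) (h : SubGaussianVec K V μ) {u : Coef d} {G : ℝ} (hu : ‖u‖ ≤ G) :
    Integrable (fun ω => Real.exp (inner ℝ (V ω) u ^ 2 / (K ^ 2 * G ^ 2))) μ ∧
      ∫ ω, Real.exp (inner ℝ (V ω) u ^ 2 / (K ^ 2 * G ^ 2)) ∂μ ≤ 2 := by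
  have hmeas : Measurable fun ω => Real.exp (inner ℝ (V ω) u ^ 2 / (K ^ 2 * G ^ 2)) := by
    fun_prop
  have hlin : ∫⁻ ω, ENNReal.ofReal (Real.exp (inner ℝ (V ω) u ^ 2 / (K ^ 2 * G ^ 2))) ∂μ ≤ 2 := by
    rcases eq_or_ne u 0 with rfl | hu0
    · simp
    · have hn : 0 < ‖u‖ := norm_pos_iff.2 hu0
      refine (lintegral_mono fun ω => ENNReal.ofReal_le_ofReal (Real.exp_le_exp.2 ?_)).trans
        (h (‖u‖⁻¹ • u) (by rw [norm_smul, norm_inv, norm_norm, inv_mul_cancel₀ hn.ne']))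
      rw [inner_smul_left, real_inner_comm, mul_comm (K ^ 2), ← div_div]
      refine div_le_div_of_nonneg_right ?_ (sq_nonneg K)
      simp only [conj_trivial]
      rw [mul_pow, inv_pow, div_eq_inv_mul]
      refine mul_le_mul_of_nonneg_right ?_ (sq_nonneg _)
      exact inv_anti₀ (by positivity) (pow_le_pow_left₀ hn.le hu 2)
  have hint : Integrable (fun ω => Real.exp (inner ℝ (V ω) u ^ 2 / (K ^ 2 * G ^ 2))) μ := by
    refine ⟨hmeas.aestronglyMeasurable, ?_⟩
    rw [hasFiniteIntegral_iff_ofReal (ae_of_all _ fun ω => (Real.exp_pos _).le)]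
    exact hlin.trans_lt (by simp)
  refine ⟨hint, ?_⟩
  rw [integral_eq_lintegral_of_nonneg_ae (ae_of_all _ fun ω => (Real.exp_pos _).le)
    hmeas.aestronglyMeasurable]
  exact ENNReal.toReal_le_of_le_ofReal zero_le_two (by simpa using hlin)

lemma le_integral_inner_sq {K α : ℝ} (hK : 0 < K) {V : Ω → Coef d}
    (hV : Measurable V) (h : SubGaussianVec K V μ)
    (hpos : (secondMoment V μ - α • 1).PosSemidef) {u : Coef d} (hu : ‖u‖ = 1) :
    α ≤ ∫ ω, inner ℝ (V ω) u ^ 2 ∂μ := by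
  -- Sub-Gaussianity along basis vectors makes the entries of the second moment genuine integrals,
  -- so integral and sum may be exchanged.
  have hcoord : ∀ a, MemLp (fun ω => V ω a) 2 μ := fun a => by
    have hm : Measurable fun ω => V ω a := by fun_prop
    refine (memLp_two_iff_integrable_sq hm.aestronglyMeasurable).2 ?_
    have he := h.integrable_exp hV (u := EuclideanSpace.single a (1 : ℝ)) (G := 1)
      (by simp)
    have := (integrable_and_integral_sq_le (μ := μ) (X := fun ω => V ω a ^ 2) (by fun_prop)
      (fun ω => sq_nonneg _) (L := K ^ 2 * 1 ^ 2) (by positivity)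
      (by simpa [EuclideanSpace.inner_single_right] using he.1)
      (by simpa [EuclideanSpace.inner_single_right] using he.2)).1
    exact this
  have hprod : ∀ a b, Integrable (fun ω => V ω a * V ω b) μ := fun a b =>
    (hcoord a).integrable_mul (hcoord b)
  have hq := hpos.dotProduct_mulVec_nonneg u.ofLp
  have hexp : ∀ ω, inner ℝ (V ω) u ^ 2 = ∑ a, ∑ b, V ω a * V ω b * (u a * u b) := fun ω => by
    rw [PiLp.inner_apply, sq, Finset.sum_mul_sum]
    refine Finset.sum_congr rfl fun a _ => Finset.sum_congr rfl fun b _ => ?_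
    simp
    ring
  simp_rw [hexp]
  rw [integral_finsetSum _ fun a _ => integrable_finsetSum _ fun b _ => (hprod a b).mul_const _]
  simp_rw [integral_finsetSum _ fun b _ => (hprod _ b).mul_const _, integral_mul_const]
  have h1 : ∑ a, u a * u a = 1 := by
    have := EuclideanSpace.norm_sq_eq u
    rw [hu] at this
    simp only [Real.norm_eq_abs, sq_abs, one_pow] at this
    simp_rw [← sq]
    exact this.symm
  rw [Matrix.sub_mulVec, dotProduct_sub, Matrix.smul_mulVec, Matrix.one_mulVec,
    dotProduct_smul] at hq
  simp only [dotProduct, Matrix.mulVec, secondMoment, Matrix.of_apply, star_trivial, h1,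
    smul_eq_mul, mul_one, Finset.mul_sum] at hq
  refine (sub_nonneg.mp hq).trans (le_of_eq ?_)
  exact Finset.sum_congr rfl fun a _ => Finset.sum_congr rfl fun b _ => by ring

end Tails

/-! ### Nets of the unit sphere -/

section Net

variable {d : ℕ}

/-- Volume comparison: the disjoint balls of radius ε/2 around the points lie in the ball of radius
1 + ε/2. -/
lemma card_le_of_separated_of_norm_le_one {ε : ℝ} (hε : 0 < ε) (S : Finset (Coef d))
    (hS : ∀ u ∈ S, ‖u‖ ≤ 1) (hsep : ∀ u ∈ S, ∀ v ∈ S, u ≠ v → ε ≤ ‖u - v‖) :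
    (S.card : ℝ) ≤ (1 + 2 / ε) ^ d := by
  set μ : Measure (Coef d) := volume
  have hδ : 0 < ε / 2 := by positivity
  have hρ : 0 < 1 + ε / 2 := by positivity
  have D : Set.Pairwise (S : Set (Coef d))
      (Function.onFun Disjoint fun c => Metric.ball c (ε / 2)) := by
    intro c hc e he hce
    refine Metric.ball_disjoint_ball ?_
    rw [dist_eq_norm, add_halves]
    exact hsep c hc e he hce
  have hsub : (⋃ c ∈ S, Metric.ball c (ε / 2)) ⊆ Metric.ball 0 (1 + ε / 2) := by
    refine Set.iUnion₂_subset fun c hc => Metric.ball_subset_ball' ?_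
    rw [dist_zero_right]
    linarith [hS c hc]
  have hmeas := measure_mono (μ := μ) hsub
  rw [measure_biUnion_finset D fun c _ => measurableSet_ball] at hmeas
  simp only [μ.addHaar_ball_of_pos _ hδ, μ.addHaar_ball_of_pos _ hρ, Finset.sum_const,
    nsmul_eq_mul, finrank_euclideanSpace_fin] at hmeas
  rw [← mul_assoc] at hmeas
  have h1 : (S.card : ENNReal) * ENNReal.ofReal ((ε / 2) ^ d)
      ≤ ENNReal.ofReal ((1 + ε / 2) ^ d) :=
    (ENNReal.mul_le_mul_iff_left (Metric.measure_ball_pos _ _ zero_lt_one).ne'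
      measure_ball_lt_top.ne).1 hmeas
  have h2 : (S.card : ℝ) * (ε / 2) ^ d ≤ (1 + ε / 2) ^ d := by
    have := ENNReal.toReal_le_of_le_ofReal (pow_nonneg hρ.le _) h1
    rwa [ENNReal.toReal_mul, ENNReal.toReal_natCast, ENNReal.toReal_ofReal (by positivity)] at this
  have h3 : 1 + 2 / ε = (1 + ε / 2) / (ε / 2) := by field_simp; ring
  rw [h3, div_pow, le_div_iff₀ (by positivity)]
  exact h2

/-- The unit sphere has an `ε`-net of at most `(1 + 2/ε)^d` points. -/
lemma exists_sphere_net (d : ℕ) {ε : ℝ} (hε : 0 < ε) :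
    ∃ S : Finset (Coef d), (∀ u ∈ S, ‖u‖ = 1) ∧ (S.card : ℝ) ≤ (1 + 2 / ε) ^ d ∧
      ∀ w : Coef d, ‖w‖ = 1 → ∃ u ∈ S, ‖w - u‖ ≤ ε := by
  classical
  -- Without a net, a separated set can always be enlarged by one point, eventually exceeding the
  -- volume bound.
  by_contra! hc
  have hall : ∀ k : ℕ, ∃ S : Finset (Coef d), S.card = k ∧ (∀ u ∈ S, ‖u‖ = 1) ∧
      ∀ u ∈ S, ∀ v ∈ S, u ≠ v → ε ≤ ‖u - v‖ := by
    intro k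
    induction k with
    | zero => exact ⟨∅, by simp⟩
    | succ k ih =>
      obtain ⟨S, hk, h1, hsep⟩ := ih
      obtain ⟨w, hw, hfar⟩ := hc S h1
        (card_le_of_separated_of_norm_le_one hε S (fun u hu => (h1 u hu).le) hsep)
      have hwS : w ∉ S := fun hwS => by
        have := hfar w hwS
        simp only [sub_self, norm_zero] at this
        linarith
      refine ⟨insert w S, by rw [Finset.card_insert_of_notMem hwS, hk], ?_, ?_⟩
      · intro u hu
        rcases Finset.mem_insert.1 hu with rfl | hu
        exacts [hw, h1 u hu]
      · intro u hu v hv huv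
        rcases Finset.mem_insert.1 hu with rfl | hu' <;>
          rcases Finset.mem_insert.1 hv with rfl | hv'
        · exact absurd rfl huv
        · exact (hfar v hv').le
        · rw [norm_sub_rev]; exact (hfar u hu').le
        · exact hsep u hu' v hv' huv
  obtain ⟨k, hk⟩ := exists_nat_gt ((1 + 2 / ε) ^ d)
  obtain ⟨S, hS, h1, hsep⟩ := hall k
  have := card_le_of_separated_of_norm_le_one hε S (fun u hu => (h1 u hu).le) hsep
  rw [hS] at this
  linarith

/-- Two-sided bounds for an operator on a net of the sphere give a lower bound everywhere. -/
lemma lower_bound_of_net {F : Type*} [NormedAddCommGroup F] [NormedSpace ℝ F]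
    (A : Coef d →L[ℝ] F) {S : Finset (Coef d)} {ε lo hi : ℝ} (hε0 : 0 ≤ ε) (hε : ε ≤ 1 / 2)
    (hhi : 0 ≤ hi) (hnet : ∀ w : Coef d, ‖w‖ = 1 → ∃ u ∈ S, ‖w - u‖ ≤ ε)
    (hlo' : ∀ u ∈ S, lo ≤ ‖A u‖) (hhi' : ∀ u ∈ S, ‖A u‖ ≤ hi) {w : Coef d} (hw : ‖w‖ = 1) :
    lo - 2 * hi * ε ≤ ‖A w‖ := by
  have hdiff : ∀ w u : Coef d, ‖w - u‖ ≤ ε → ‖A w - A u‖ ≤ ‖A‖ * ε := fun w u h => by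
    rw [← map_sub]
    exact (A.le_opNorm _).trans (mul_le_mul_of_nonneg_left h (norm_nonneg A))
  -- A self-bounding estimate; since ε ≤ 1/2 it gives ‖A‖ ≤ 2·hi.
  have hA : ‖A‖ ≤ hi + ‖A‖ * ε := by
    refine A.opNorm_le_of_unit_norm (by positivity) fun w hw => ?_
    obtain ⟨u, hu, hwu⟩ := hnet w hw
    have h1 := norm_le_norm_add_norm_sub' (A w) (A u)
    linarith [hdiff w u hwu, hhi' u hu]
  have hA2 : ‖A‖ ≤ 2 * hi := by nlinarith [norm_nonneg A]
  obtain ⟨u, hu, hwu⟩ := hnet w hw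
  have h1 := norm_le_norm_add_norm_sub (A w) (A u)
  have h2 := hdiff w u hwu
  have h3 : ‖A‖ * ε ≤ 2 * hi * ε := mul_le_mul_of_nonneg_right hA2 hε0
  have h4 := hlo' u hu
  linarith

end Net

/-! ### The two covariate events -/

section Events

lemma iIndepFun_inner_sq {Ω ι : Type*} [MeasurableSpace Ω] {μ : Measure Ω} {d : ℕ}
    {V : ι → Ω → Coef d} (h : iIndepFun V μ) (u : ι → Coef d) :
    iIndepFun (fun k ω => (inner ℝ (V k ω) (u k) : ℝ) ^ 2) μ :=
  h.comp (fun k v => (inner ℝ v (u k) : ℝ) ^ 2) fun k => by fun_prop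

/-- The map `v ↦ (⟨V_k, v⟩)_k` evaluating a model at all data points. -/
noncomputable def evalOp {ι : Type*} [Fintype ι] {d : ℕ} (V : ι → Coef d) :
    Coef d →L[ℝ] EuclideanSpace ℝ ι :=
  (PiLp.continuousLinearEquiv 2 ℝ (fun _ : ι => ℝ)).symm.toContinuousLinearMap.comp
    (ContinuousLinearMap.pi fun k => innerSL ℝ (V k))

lemma norm_evalOp_sq {ι : Type*} [Fintype ι] {d : ℕ} (V : ι → Coef d) (v : Coef d) :
    ‖evalOp V v‖ ^ 2 = ∑ k, (inner ℝ (V k) v : ℝ) ^ 2 := by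
  simp [EuclideanSpace.norm_sq_eq, evalOp]

/-- Deterministic lower bound for the pooled second moment from two-sided bounds on a net. -/
lemma pooled_lower_of_net {ι : Type*} [Fintype ι] [Nonempty ι] {d : ℕ} {V : ι → Coef d}
    {S : Finset (Coef d)} {α B ε : ℝ} (hε0 : 0 ≤ ε) (hε : ε ≤ 1 / 2)
    (hgap : 2 * √B * ε ≤ √(3 * α / 4) - √(α / 2))
    (hnet : ∀ w : Coef d, ‖w‖ = 1 → ∃ u ∈ S, ‖w - u‖ ≤ ε)
    (hlo : ∀ u ∈ S, Fintype.card ι * (3 * α / 4) ≤ ∑ k, (inner ℝ (V k) u : ℝ) ^ 2)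
    (hhi : ∀ u ∈ S, ∑ k, (inner ℝ (V k) u : ℝ) ^ 2 ≤ Fintype.card ι * B) (v : Coef d) :
    α / 2 * ‖v‖ ^ 2 ≤ 1 / (Fintype.card ι : ℝ) * ∑ k, (inner ℝ (V k) v : ℝ) ^ 2 := by
  have hN : (0 : ℝ) < Fintype.card ι := by exact_mod_cast Fintype.card_pos
  set N : ℝ := (Fintype.card ι : ℝ) with hNdef
  rw [one_div, le_inv_mul_iff₀ hN]
  have hunit : ∀ w : Coef d, ‖w‖ = 1 → N * (α / 2) ≤ ‖evalOp V w‖ ^ 2 := fun w hw => by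
    have h := lower_bound_of_net (evalOp V) (lo := √(N * (3 * α / 4))) (hi := √(N * B)) hε0 hε
      (Real.sqrt_nonneg _) hnet
      (fun u hu => Real.sqrt_le_iff.2 ⟨norm_nonneg _, by rw [norm_evalOp_sq]; exact hlo u hu⟩)
      (fun u hu => Real.le_sqrt_of_sq_le (by rw [norm_evalOp_sq]; exact hhi u hu)) hw
    have h2 : √(N * (α / 2)) ≤ ‖evalOp V w‖ := by
      refine le_trans ?_ h
      rw [Real.sqrt_mul hN.le, Real.sqrt_mul hN.le, Real.sqrt_mul hN.le]
      nlinarith [mul_le_mul_of_nonneg_left hgap (Real.sqrt_nonneg N)]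
    exact (Real.sqrt_le_left (norm_nonneg _)).1 h2
  rcases eq_or_ne v 0 with rfl | hv
  · simp
  · have hn : ‖v‖ ≠ 0 := norm_ne_zero_iff.2 hv
    have h := hunit (‖v‖⁻¹ • v) (by rw [norm_smul, norm_inv, norm_norm, inv_mul_cancel₀ hn])
    rw [map_smul, norm_smul, norm_inv, norm_norm, mul_pow, inv_pow, norm_evalOp_sq,
      le_inv_mul_iff₀ (by positivity)] at h
    linarith

/-- Lower tail of the smallest eigenvalue of the pooled empirical second moment. -/
lemma exists_pooled_lower_event {α K : ℝ} (hα : 0 < α) (hK : 0 < K) :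
    ∃ c₁ c₃ : ℝ, 0 < c₁ ∧ 0 < c₃ ∧
      ∀ {Ω ι : Type*} [MeasurableSpace Ω] [Fintype ι] (μ : Measure Ω) [IsProbabilityMeasure μ]
        (d : ℕ) (V : ι → Ω → Coef d), (∀ k, Measurable (V k)) → iIndepFun V μ →
        (∀ k, SubGaussianVec K (V k) μ) →
        (∀ k, (secondMoment (V k) μ - α • 1).PosSemidef) →
        c₁ * (d : ℝ) ≤ Fintype.card ι →
        ∃ E : Set Ω, MeasurableSet E ∧ 1 - Real.exp (-(d : ℝ)) ≤ μ.real E ∧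
          1 - Real.exp (-(c₃ * Fintype.card ι)) ≤ μ.real E ∧
          ∀ ω ∈ E, ∀ v : Coef d, α / 2 * ‖v‖ ^ 2
            ≤ 1 / (Fintype.card ι : ℝ) * ∑ k, (inner ℝ (V k ω) v : ℝ) ^ 2 := by
  -- The lower-tail rate with L = K²; B below is the level at which the upper tail has the same
  -- rate.
  set c : ℝ := α ^ 2 / (128 * (K ^ 2) ^ 2) with hc
  have hc0 : 0 < c := by positivity
  set B : ℝ := K ^ 2 * (Real.log 2 + c) with hB
  have hB0 : 0 < B := by
    have := Real.log_pos one_lt_two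
    positivity
  have hgap : 0 < √(3 * α / 4) - √(α / 2) :=
    sub_pos.2 (Real.sqrt_lt_sqrt (by positivity) (by linarith))
  -- Fine enough that passing from the net to the sphere lowers 3α/4 to no less than α/2.
  set ε : ℝ := min (1 / 2) ((√(3 * α / 4) - √(α / 2)) / (2 * √B)) with hε
  have hsB : 0 < 2 * √B := by positivity
  have hε0 : 0 < ε := lt_min (by norm_num) (div_pos hgap hsB)
  have hεgap : 2 * √B * ε ≤ √(3 * α / 4) - √(α / 2) := by
    rw [mul_comm, ← le_div_iff₀ hsB]
    exact min_le_right _ _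
  set A : ℝ := 1 + 2 / ε with hA
  have hA1 : 1 ≤ A := by
    have : 0 ≤ 2 / ε := by positivity
    linarith
  have hlog : 0 < Real.log (2 * A) := Real.log_pos (by linarith)
  -- With this c₁ half of the exponent cN pays for the factor (2A)^d of the union bound; the summand
  -- 1 makes cN/2 at least d, so both probability bounds follow.
  refine ⟨2 * (Real.log (2 * A) + 1) / c, c / 2, by positivity, by positivity, ?_⟩
  intro Ω ι _ _ μ _ d V hV hind hsub hpsd hN
  rcases d.eq_zero_or_pos with rfl | hd
  · refine ⟨Set.univ, MeasurableSet.univ, by simp, ?_, fun ω _ v => ?_⟩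
    · simp [(Real.exp_pos _).le]
    · rw [Subsingleton.elim v 0]
      simp
  have hd1 : (1 : ℝ) ≤ d := by exact_mod_cast hd
  set N : ℝ := (Fintype.card ι : ℝ) with hNdef
  have hN2 : (Real.log (2 * A) + 1) * d ≤ c / 2 * N := by
    rw [div_mul_eq_mul_div, div_le_iff₀ hc0] at hN
    linarith
  have hN0 : 0 < N := by
    by_contra hcon
    push Not at hcon
    have h1 : 0 < (Real.log (2 * A) + 1) * d := by positivity
    have h2 : c / 2 * N ≤ 0 := mul_nonpos_of_nonneg_of_nonpos (by positivity) hcon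
    linarith
  have : Nonempty ι := Fintype.card_pos_iff.1 (Nat.cast_pos.1 hN0)
  obtain ⟨S, hS1, hScard, hnet⟩ := exists_sphere_net d hε0
  set X : Coef d → Ω → ℝ := fun u ω => ∑ k, (inner ℝ (V k ω) u : ℝ) ^ 2 with hX
  have hXm : ∀ u, Measurable (X u) := fun u => by
    simp only [hX]
    fun_prop
  set bad : Coef d → Set Ω := fun u => {ω | X u ω ≤ N * (3 * α / 4)} ∪ {ω | N * B ≤ X u ω}
    with hbad
  have hbadm : ∀ u, MeasurableSet (bad u) := fun u =>
    (measurableSet_le (hXm u) measurable_const).union (measurableSet_le measurable_const (hXm u))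
  have hU : MeasurableSet (⋃ u ∈ S, bad u) :=
    Finset.measurableSet_biUnion S fun u _ => hbadm u
  have hbadle : ∀ u ∈ S, μ.real (bad u) ≤ 2 * Real.exp (-(c * N)) := fun u hu => by
    have hexp := fun k => (hsub k).integrable_exp (hV k) (hS1 u hu).le
    simp only [one_pow, mul_one] at hexp
    have hm : ∀ k, Measurable fun ω => (inner ℝ (V k ω) u : ℝ) ^ 2 := fun k => by
      have := hV k
      fun_prop
    have h1 := measureReal_sum_le_le hm (iIndepFun_inner_sq hind fun _ => u)
      (fun k ω => sq_nonneg _) (by positivity) hα (fun k => (hexp k).1) (fun k => (hexp k).2)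
      (fun k => le_integral_inner_sq hK (hV k) (hsub k) (hpsd k) (hS1 u hu))
    have h2 := measureReal_sum_ge_le hm (iIndepFun_inner_sq hind fun _ => u)
      (by positivity) (fun k => (hexp k).1) (fun k => (hexp k).2) c
    calc μ.real (bad u) ≤ _ := measureReal_union_le _ _
      _ ≤ Real.exp (-(c * N)) + Real.exp (-(c * N)) := add_le_add h1 h2
      _ = _ := by ring
  have hfail : μ.real (⋃ u ∈ S, bad u) ≤ Real.exp (-(c / 2 * N)) := by
    calc μ.real (⋃ u ∈ S, bad u) ≤ ∑ u ∈ S, μ.real (bad u) := measureReal_biUnion_finset_le _ _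
      _ ≤ ∑ _u ∈ S, 2 * Real.exp (-(c * N)) := Finset.sum_le_sum hbadle
      _ = S.card * (2 * Real.exp (-(c * N))) := by rw [Finset.sum_const, nsmul_eq_mul]
      _ ≤ A ^ d * (2 * Real.exp (-(c * N))) :=
        mul_le_mul_of_nonneg_right hScard (by positivity)
      -- Uses d ≥ 1; the case d = 0 was settled separately.
      _ ≤ A ^ d * (2 ^ d * Real.exp (-(c * N))) := by
        gcongr
        exact le_self_pow₀ one_le_two hd.ne'
      _ = Real.exp (d * Real.log (2 * A)) * Real.exp (-(c * N)) := by
        rw [Real.exp_nat_mul, Real.exp_log (by linarith), mul_pow]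
        ring
      _ = Real.exp (d * Real.log (2 * A) - c * N) := by rw [← Real.exp_add, sub_eq_add_neg]
      _ ≤ _ := Real.exp_le_exp.2 (by linarith)
  have hE : 1 - Real.exp (-(c / 2 * N)) ≤ μ.real (⋃ u ∈ S, bad u)ᶜ := by
    rw [probReal_compl_eq_one_sub hU]
    linarith
  refine ⟨(⋃ u ∈ S, bad u)ᶜ, hU.compl, ?_, hE, fun ω hω v => ?_⟩
  · refine le_trans (sub_le_sub_left (Real.exp_le_exp.2 ?_) 1) hE
    nlinarith
  · have hgood : ∀ u ∈ S, N * (3 * α / 4) ≤ X u ω ∧ X u ω ≤ N * B := fun u hu => by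
      have h : ω ∉ bad u := fun hb => hω (Set.mem_biUnion hu hb)
      simp only [hbad, Set.mem_union, Set.mem_ofPred_eq, not_or, not_le] at h
      exact ⟨h.1.le, h.2.le⟩
    exact pooled_lower_of_net hε0.le (min_le_left _ _) hεgap hnet
      (fun u hu => (hgood u hu).1) (fun u hu => (hgood u hu).2) v

/-- The vectors u_k do not depend on the sample, so no net is needed. The case G = 0 is separate
because the Chernoff scale K²G² must be positive. -/
lemma exists_upper_event {Ω ι : Type*} [MeasurableSpace Ω] [Fintype ι] (μ : Measure Ω)
    [IsProbabilityMeasure μ] {K : ℝ} (hK : 0 < K) {d : ℕ} {V : ι → Ω → Coef d}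
    (hV : ∀ k, Measurable (V k)) (hind : iIndepFun V μ) (hsub : ∀ k, SubGaussianVec K (V k) μ)
    {G : ℝ} (hG : 0 ≤ G) {u : ι → Coef d} (hu : ∀ k, ‖u k‖ ≤ G) :
    ∃ E : Set Ω, MeasurableSet E ∧ 1 - Real.exp (-(Fintype.card ι : ℝ)) ≤ μ.real E ∧
      ∀ ω ∈ E, ∑ k, (inner ℝ (V k ω) (u k) : ℝ) ^ 2
        ≤ Fintype.card ι * (K ^ 2 * G ^ 2 * (Real.log 2 + 1)) := by
  rcases hG.eq_or_lt with rfl | hG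
  · refine ⟨Set.univ, MeasurableSet.univ, by simp [(Real.exp_pos _).le], fun ω _ => ?_⟩
    have h0 : ∀ k, u k = 0 := fun k => norm_eq_zero.1 (le_antisymm (hu k) (norm_nonneg _))
    simp [h0]
  have hm : ∀ k, Measurable fun ω => (inner ℝ (V k ω) (u k) : ℝ) ^ 2 := fun k => by
    have := hV k
    fun_prop
  have hexp := fun k => (hsub k).integrable_exp (hV k) (hu k)
  have h := measureReal_sum_ge_le hm (iIndepFun_inner_sq hind u)
    (by positivity) (fun k => (hexp k).1) (fun k => (hexp k).2) 1
  rw [one_mul] at h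
  have hU : MeasurableSet {ω | (Fintype.card ι : ℝ) * (K ^ 2 * G ^ 2 * (Real.log 2 + 1))
      ≤ ∑ k, (inner ℝ (V k ω) (u k) : ℝ) ^ 2} :=
    measurableSet_le measurable_const (Finset.measurable_sum _ fun k _ => hm k)
  refine ⟨_, hU.compl, ?_, fun ω hω => ?_⟩
  · rw [probReal_compl_eq_one_sub hU]
    linarith
  · simp only [Set.mem_compl_iff, Set.mem_ofPred_eq, not_le] at hω
    exact hω.le

end Events

/-! ### The bias bound in terms of the heterogeneity -/

section Global

variable {𝒳 : Type*} {d M : ℕ} {n : Fin M → ℕ}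

lemma card_sigma_eq_total (n : Fin M → ℕ) : Fintype.card (Σ i, Fin (n i)) = total n := by
  simp [total]

lemma norm_sub_le_heterogeneity (θs : Fin M → Coef d) (i j : Fin M) :
    ‖θs i - θs j‖ ≤ heterogeneity θs :=
  le_ciSup (f := fun p : Fin M × Fin M => ‖θs p.1 - θs p.2‖) (Set.finite_range _).bddAbove (i, j)

/-- Dividing by r gives squared distance at most 2κD/α to θ*_{i₀}; the summand 1 in the constant
pays for moving from i₀ to j, using κ ≥ 1. -/
lemma RoundBounds.norm_thetaBar_sub_le {alg : FLAlgorithm} {η α K κ : ℝ} (hη : 0 < η)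
    (hα : 0 < α) (hK : 0 < K) (hs : 1 ≤ alg.steps) (hκ : 1 ≤ κ) (hn : ∀ i, 0 < n i)
    (hN : 0 < total n) {φ : 𝒳 → Coef d} {x : ∀ i, Fin (n i) → 𝒳}
    (h : RoundBounds alg η (η * (alg.steps / κ) * (α / 2)) φ x)
    (θs : Fin M → Coef d) (i₀ j : Fin M)
    (hD : ∑ i, ∑ j, (inner ℝ (φ (x i j)) (θs i - θs i₀) : ℝ) ^ 2
      ≤ total n * (K ^ 2 * heterogeneity θs ^ 2 * (Real.log 2 + 1))) :
    ‖thetaBar alg η φ x θs - θs j‖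
      ≤ (K * √(2 * (Real.log 2 + 1) / α) + 1) * heterogeneity θs * √κ := by
  set G := heterogeneity θs with hG
  have hG0 : 0 ≤ G := (norm_nonneg _).trans (norm_sub_le_heterogeneity θs i₀ i₀)
  have hs0 : (0 : ℝ) < alg.steps := by exact_mod_cast hs
  have hκ0 : 0 < κ := by linarith
  have hlog := Real.log_pos one_lt_two
  have h1 := h.norm_thetaBar_sub_sq_le hη (by positivity) hn hN θs (θs i₀) hD
  have h2 : ‖thetaBar alg η φ x θs - θs i₀‖ ^ 2
      ≤ (K * √(2 * (Real.log 2 + 1) / α) * G * √κ) ^ 2 := by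
    rw [mul_pow, mul_pow, mul_pow, Real.sq_sqrt (by positivity), Real.sq_sqrt hκ0.le]
    rw [← le_div_iff₀' (by positivity)] at h1
    refine h1.trans (le_of_eq ?_)
    field_simp
  have h3 : ‖thetaBar alg η φ x θs - θs i₀‖ ≤ K * √(2 * (Real.log 2 + 1) / α) * G * √κ :=
    le_of_sq_le_sq h2 (by positivity)
  have h4 : G ≤ G * √κ := le_mul_of_one_le_right hG0 (Real.one_le_sqrt.2 hκ)
  calc ‖thetaBar alg η φ x θs - θs j‖
      ≤ ‖thetaBar alg η φ x θs - θs i₀‖ + ‖θs i₀ - θs j‖ := norm_sub_le_norm_sub_add_norm_sub ..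
    _ ≤ K * √(2 * (Real.log 2 + 1) / α) * G * √κ + G * √κ :=
      add_le_add h3 ((norm_sub_le_heterogeneity θs i₀ j).trans h4)
    _ = _ := by ring

end Global

end FedLearn

/-! ### Assembly of the estimates on the events -/

theorem mainTheorem6 (α β K : ℝ) (hα : 0 < α) (hβ : 0 < β) (hK : 0 < K) :
    ∃ c₁ c₂ c₃ : ℝ, 0 < c₁ ∧ 0 < c₂ ∧ 0 < c₃ ∧
      ∀ {Ω 𝒳 : Type*} [MeasurableSpace Ω] (μ : Measure Ω) [IsProbabilityMeasure μ]
        (d M : ℕ) (n : Fin M → ℕ) (φ : 𝒳 → FedLearn.Coef d)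
        (x : ∀ i, Fin (n i) → Ω → 𝒳) (θs : Fin M → FedLearn.Coef d),
        (∀ i, 0 < n i) →
        (∀ i j, Measurable fun ω => φ (x i j ω)) →
        iIndepFun (fun (k : Σ i, Fin (n i)) (ω : Ω) => φ (x k.1 k.2 ω)) μ →
        (∀ i j, FedLearn.SubGaussianVec K (fun ω => φ (x i j ω)) μ) →
        (∀ i j,
          (FedLearn.secondMoment (fun ω => φ (x i j ω)) μ - α • 1).PosSemidef ∧
          (β • 1 - FedLearn.secondMoment (fun ω => φ (x i j ω)) μ).PosSemidef) →
        c₁ * (d : ℝ) ≤ (FedLearn.total n : ℝ) →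
        ∃ E E' : Set Ω, MeasurableSet E ∧ MeasurableSet E' ∧
          1 - Real.exp (-(d : ℝ)) ≤ μ.real E ∧
          1 - Real.exp (-(c₃ * (FedLearn.total n : ℝ))) ≤ μ.real E ∧
          1 - Real.exp (-(FedLearn.total n : ℝ)) ≤ μ.real E' ∧
          ∀ ω ∈ E, ∀ (alg : FedLearn.FLAlgorithm) (η : ℝ), 1 ≤ alg.steps → 0 < η →
            ((∃ s, alg = FedLearn.FLAlgorithm.fedAvg s) →
              FedLearn.gam η φ (fun i j => x i j ω) < 1) →
            IsUnit (1 - FedLearn.roundOp alg η φ (fun i j => x i j ω)) ∧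
            (∀ (σ : ℝ) (ν : Measure (∀ i, Fin (n i) → ℝ)), FedLearn.IsNoiseLaw σ ν →
              ∀ (θ₀ : FedLearn.Coef d) (t : ℕ),
                Integrable (fun z =>
                  ‖FedLearn.globalModel alg η φ (fun i j => x i j ω)
                      (FedLearn.response φ (fun i j => x i j ω) θs z) θ₀ t
                    - FedLearn.thetaBar alg η φ (fun i j => x i j ω) θs‖ ^ 2) ν ∧
                ∫ z, ‖FedLearn.globalModel alg η φ (fun i j => x i j ω)
                      (FedLearn.response φ (fun i j => x i j ω) θs z) θ₀ t
                    - FedLearn.thetaBar alg η φ (fun i j => x i j ω) θs‖ ^ 2 ∂ν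
                  ≤ (1 - (alg.steps : ℝ) * η * α
                        / (2 * FedLearn.kap alg η φ (fun i j => x i j ω))) ^ (2 * t)
                      * ‖θ₀ - FedLearn.thetaBar alg η φ (fun i j => x i j ω) θs‖ ^ 2
                    + σ ^ 2 * (2 * FedLearn.kap alg η φ (fun i j => x i j ω) * (d : ℝ)
                        / ((FedLearn.total n : ℝ) * α))) ∧
            (ω ∈ E' → ∀ j,
              ‖FedLearn.thetaBar alg η φ (fun i j => x i j ω) θs - θs j‖
                ≤ c₂ * FedLearn.heterogeneity θs
                    * Real.sqrt (FedLearn.kap alg η φ (fun i j => x i j ω))) := by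
  obtain ⟨c₁, c₃, hc₁, hc₃, hevent⟩ := FedLearn.exists_pooled_lower_event hα hK
  refine ⟨c₁, K * √(2 * (Real.log 2 + 1) / α) + 1, c₃, hc₁, by positivity, hc₃, ?_⟩
  intro Ω 𝒳 _ μ _ d M n φ x θs hn hmeas hind hsub hmom hN
  set V : (Σ i, Fin (n i)) → Ω → FedLearn.Coef d := fun k ω => φ (x k.1 k.2 ω) with hV
  rw [← FedLearn.card_sigma_eq_total] at hN
  obtain ⟨E, hEm, hE1, hE2, hElow⟩ := hevent μ d V (fun k => hmeas k.1 k.2) hind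
    (fun k => hsub k.1 k.2) (fun k => (hmom k.1 k.2).1) hN
  -- One reference client i₀ serves all j, which keeps the failure probability at e^{-N} without a
  -- union over clients. The premise `Fin M` covers M = 0, where no reference exists.
  have hE' : ∃ E' : Set Ω, MeasurableSet E' ∧
      1 - Real.exp (-(FedLearn.total n : ℝ)) ≤ μ.real E' ∧ ∀ ω ∈ E', Fin M → ∃ i₀ : Fin M,
        ∑ i, ∑ j, (inner ℝ (φ (x i j ω)) (θs i - θs i₀) : ℝ) ^ 2 ≤ FedLearn.total n
          * (K ^ 2 * FedLearn.heterogeneity θs ^ 2 * (Real.log 2 + 1)) := by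
    rcases isEmpty_or_nonempty (Fin M) with hM | ⟨⟨i₀⟩⟩
    · exact ⟨Set.univ, MeasurableSet.univ, by simp [(Real.exp_pos _).le],
        fun _ _ i => isEmptyElim i⟩
    · obtain ⟨E', hm, hp, hb⟩ := FedLearn.exists_upper_event μ hK (V := V)
        (fun k => hmeas k.1 k.2) hind
        (fun k => hsub k.1 k.2)
        ((norm_nonneg _).trans (FedLearn.norm_sub_le_heterogeneity θs i₀ i₀))
        (u := fun k => θs k.1 - θs i₀) fun k => FedLearn.norm_sub_le_heterogeneity θs k.1 i₀
      simp only [FedLearn.card_sigma_eq_total, Fintype.sum_sigma] at hp hb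
      exact ⟨E', hm, hp, fun ω hω _ => ⟨i₀, hb ω hω⟩⟩
  obtain ⟨E', hEm', hp', hb'⟩ := hE'
  simp only [FedLearn.card_sigma_eq_total, Fintype.sum_sigma] at hN hE2 hElow
  refine ⟨E, E', hEm, hEm', hE1, hE2, hp', fun ω hω alg η hs hη hγ1 => ?_⟩
  -- For d = 0 positivity of γ and κ ≥ 1 are not available, but every norm is 0.
  rcases d.eq_zero_or_pos with rfl | hd
  · have h0 : ∀ v : FedLearn.Coef 0, ‖v‖ = 0 := fun v => by
      rw [Subsingleton.elim v 0, norm_zero]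
    refine ⟨isUnit_of_subsingleton _, fun σ ν _ θ₀ t => ?_, fun _ j => ?_⟩
    · simp [h0]
    · rw [h0]
      have hG : 0 ≤ FedLearn.heterogeneity θs :=
        (norm_nonneg _).trans (FedLearn.norm_sub_le_heterogeneity θs j j)
      have := Real.log_pos one_lt_two
      positivity
  have hlow : FedLearn.PooledLower (α / 2) φ (fun i j => x i j ω) := hElow ω hω
  have hNpos : 0 < FedLearn.total n := by
    have : (0 : ℝ) < FedLearn.total n := lt_of_lt_of_le (by positivity) hN
    exact_mod_cast this
  have hγ := FedLearn.gam_pos hη (by positivity) hd hn hlow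
  have hκ : 1 ≤ FedLearn.kap alg η φ (fun i j => x i j ω) := by
    rw [FedLearn.kap_eq_kapOf]
    exact FedLearn.one_le_kapOf hs hγ hγ1
  set κ := FedLearn.kap alg η φ (fun i j => x i j ω)
  have hκ0 : 0 < κ := by linarith
  have hs0 : (0 : ℝ) < alg.steps := by exact_mod_cast hs
  have hR := FedLearn.roundBounds hη hn hNpos hlow hκ0 hγ1
  have hr : 0 < η * (alg.steps / κ) * (α / 2) := by positivity
  refine ⟨hR.isUnit hr, fun σ ν hν θ₀ t => ?_, fun hω' j => ?_⟩
  · have h := hR.integral_error_le hη hr θs hν θ₀ t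
    have hN' : (0 : ℝ) < FedLearn.total n := by exact_mod_cast hNpos
    have e1 : (alg.steps : ℝ) * η * α / (2 * κ) = η * (alg.steps / κ) * (α / 2) := by
      field_simp
    have e2 : 2 * κ * (d : ℝ) / ((FedLearn.total n : ℝ) * α)
        = η * alg.steps / FedLearn.total n * (d / (η * (alg.steps / κ) * (α / 2))) := by
      field_simp
    rw [e1, e2]
    exact h
  · obtain ⟨i₀, hD⟩ := hb' ω hω' j
    exact hR.norm_thetaBar_sub_le hη hα hK hs hκ hn hNpos θs i₀ j hD
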